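/- **Setting.** A conference has $n$ papers and an even number $m$ of reviewers; $J\subseteq[n]$ is the set of papers with a property of interest, $w_j=1$ if $j\in J$ and $w_j=-1$ otherwise. Reviewer $i$ accepts paper $j$, if assigned to it, with probability $\pi^{\mathrm{sb}}_{ij}$ in the single-blind (SB) condition and $\pi^{\mathrm{db}}_{ij}$ in the double-blind (DB) condition. Different reviewers decide independently; decisions of one reviewer on different papers may be dependent. Fix a paper load $\lambda\ge1$, a reviewer load $\mu\ge1$ and a level $\alpha\in(0,1)$. **Procedure.** Reviewers bid blindly (without knowing authors). An arbitrary, possibly randomized, assignment algorithm assigns two reviewers to each selected paper, each reviewer getting at most one paper (assignment $A^*$): if $m\ge 2n$ all papers are selected, and $2n$ reviewers are used, which are chosen uniformly at random if $m>2n$; if $m<2n$ all reviewers are used, and $m/2$ papers are selected such that the numbers of selected papers in $J$ and outside $J$ are as close to each other as possible. For each paper in $A^*$ a fair coin, independently, puts one of its two reviewers into SB and the other into DB; of the remaining reviewers a uniformly random half goes to SB and the other half to DB. The algorithm extends $A^*$ to an assignment with $\lambda$ SB and $\lambda$ DB reviewers per paper and at most $\mu$ papers per reviewer (so $2\lambda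 n\le\mu m$). After the reviews, for each paper $j$ in $A^*$ with SB reviewer $i_1$ and DB reviewer $i_2$ of $A^*$ one forms the tuple $(j,Y_j,X_j,w_j)$ of their decisions $Y_j,X_j\in\{0,1\}$ ($1$ means accept), where $Y_j$ is the decision of $i_1$ and $X_j$ that of $i_2$. A test is run on these tuples. **Tests.** *Counting*: let $U$ (resp. $V$) be the array of the $Y_j-X_j$ over tuples with $w_j=1$ (resp. $-1$); reject iff both are non-empty and the difference $\gamma$ of their means satisfies $|\gamma|>\sqrt{2(|U|^{-1}+|V|^{-1})\log(2/\alpha)}$. *Disagreement*: let $U$ (resp. $V$) be the array of the $Y_j$ over tuples with $Y_j\ne X_j$ and $w_j=1$ (resp. $-1$); reject iff both are non-empty and the permutation test at level $\alpha$ with statistic $|\tau|$, $\tau$ the difference of the means of $U$ and $V$, rejects, that is, iff the fraction of permutations of the pooled array for which $|\tau|$ is at least the observed value is at most $\alpha$. **Guarantees.** Given a class $\mathcal F$ of functions and a model of the DB matrix $(\pi^{\mathrm{db}}_{ij})$, a test *controls Type-I error at level $\alpha$* if it rejects with probability at most $\alpha$ whenever the DB matrix follows the model and $\pi^{\mathrm{sb}}_{ij}=f(\pi^{\mathrm{db}}_{ij})$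 for all $i,j$ and some $f\in\mathcal F$. It has *non-trivial power* if for all $\varepsilon,\delta>0$ there is $n_0$ (which may depend on $\varepsilon,\delta$ and on the constants $\lambda,\mu,\alpha$ and the model parameter) such that, if $\min\{|J|,|[n]\setminus J|\}>n_0$, it rejects with probability at least $1-\varepsilon$ whenever the DB matrix follows the model and, for some $f\in\mathcal F$, $|\pi^{\mathrm{sb}}_{ij}-f(\pi^{\mathrm{db}}_{ij})|>\delta$ for all $i,j$, with $\pi^{\mathrm{sb}}_{ij}\ge f(\pi^{\mathrm{db}}_{ij})$ for $j\in J$ and $\pi^{\mathrm{sb}}_{ij}\le f(\pi^{\mathrm{db}}_{ij})$ for $j\notin J$ (or the same with $J$ and its complement exchanged). **Theorem.** Let the experiment be organized by the procedure above. (a) *Generalized linear model*, any $\Delta\in(0,\tfrac12)$: $\pi^{\mathrm{db}}_{ij}=q_j$ with unknown $q_j\in(\Delta,1-\Delta)$, and $\mathcal F=\{t\mapsto t+\nu:\nu\in(-\Delta,\Delta)\}$ on $(\Delta,1-\Delta)$. The Counting test controls Type-I error at level $\alpha$ and has non-trivial power. (b) *Generalized logistic model*, any $\widetilde\Delta>0$: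 $\pi^{\mathrm{db}}_{ij}\in(0,1)$ and $\log\frac{\pi^{\mathrm{db}}_{ij}}{1-\pi^{\mathrm{db}}_{ij}}=\beta_0+\beta_1q_j$ with unknown $q_j\in(-\widetilde\Delta,\widetilde\Delta)$, $|\beta_0|\le\widetilde\Delta$, $0<\beta_1\le\widetilde\Delta$, and $\mathcal F=\{t\mapsto \frac{te^{\nu}}{1-t+te^{\nu}}:\nu\in(-\widetilde\Delta,\widetilde\Delta)\}$ (the shifts of the log-odds by $\nu$). The Disagreement test controls Type-I error at level $\alpha$ and has non-trivial power. -/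

import Mathlib

open scoped ENNReal

noncomputable section

namespace BiasTest

/-! ### Independent products of finitely supported laws -/

/-- The joint law of independent random elements `x i ∼ p i`, `i ∈ ι` (both types finite). -/
def independent {ι α : Type} [Fintype ι] [DecidableEq ι] [Fintype α] (p : ι → PMF α) :
    PMF (ι → α) :=
  PMF.ofFintype (fun x => ∏ i, p i (x i)) (by
    have h := Finset.prod_univ_sum (fun _ : ι => (Finset.univ : Finset α)) (fun i a => p i a)
    rw [Fintype.piFinset_univ] at h
    rw [← h]
    refine Finset.prod_eq_one fun i _ => ?_
    have h1 := (p i).tsum_coe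
    rwa [tsum_fintype] at h1)

/-! ### The two statistical tests

There are `n` papers; `J` is the set of papers that satisfy the property of interest. -/

/-- The tuple `(j, Y_j, X_j, w_j)`: a paper, the decision of its SB (single-blind) reviewer, the
decision of its DB (double-blind) reviewer (`true` is "accept"), and the indicator of the
property, `1` or `-1`. -/
structure ReviewTuple (n : ℕ) where
  paper : Fin n
  Y : Bool
  X : Bool
  w : ℤ

/-- A set of tuples with at most one tuple for each paper, as a family indexed by papers. -/
abbrev TupleSet (n : ℕ) : Type := Σ P : Finset (Fin n), (P → ReviewTuple n)

/-- The mean of `z` over the entries with `w = 1` (the array `U`) minus its mean over the entries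
with `w = -1` (the array `V`). -/
def meanGap {κ : Type} [Fintype κ] (w : κ → ℤ) (z : κ → ℝ) : ℝ :=
  (∑ k with w k = 1, z k) / (Finset.card {k | w k = 1} : ℝ)
    - (∑ k with w k = -1, z k) / (Finset.card {k | w k = -1} : ℝ)

/-- The p-value of the exact permutation test for exchangeability of all entries of `U` and `V`
with statistic `|meanGap|`: the fraction of all permutations of the pooled array for which
the statistic is at least as large as the observed one. -/
def permutationPValue {κ : Type} [Fintype κ] [DecidableEq κ] (w : κ → ℤ) (z : κ → ℝ) : ℝ :=
  (Finset.card {σ : Equiv.Perm κ | |meanGap w z| ≤ |meanGap w (fun k => z (σ k))|} : ℝ)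
    / ((Fintype.card κ).factorial : ℝ)

/-- The Disagreement test at level `α` rejects the null hypothesis: only the tuples with `Y ≠ X`
enter, with the SB decision `Y`; both arrays are non-empty, and the permutation test rejects. -/
def disagreementRejects (α : ℝ) (n : ℕ) (T : TupleSet n) : Prop :=
  let w : {t : T.1 // (T.2 t).Y ≠ (T.2 t).X} → ℤ := fun t => (T.2 t).w
  let y : {t : T.1 // (T.2 t).Y ≠ (T.2 t).X} → ℝ := fun t => ((T.2 t).Y.toNat : ℝ)
  (∃ t, w t = 1) ∧ (∃ t, w t = -1) ∧ permutationPValue w y ≤ α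

/-- The Counting test at level `α` rejects the null hypothesis: all tuples enter, with the
difference `Y - X`; both arrays are non-empty, and `|γ|` exceeds the threshold. -/
def countingRejects (α : ℝ) (n : ℕ) (T : TupleSet n) : Prop :=
  let w : T.1 → ℤ := fun t => (T.2 t).w
  let z : T.1 → ℝ := fun t => ((T.2 t).Y.toNat : ℝ) - ((T.2 t).X.toNat : ℝ)
  (∃ t, w t = 1) ∧ (∃ t, w t = -1) ∧
    Real.sqrt (2 * ((Finset.card {t | w t = 1} : ℝ)⁻¹ + (Finset.card {t | w t = -1} : ℝ)⁻¹)
      * Real.log (2 / α)) < |meanGap w z|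

/-! ### The experimental procedure

There are `m` reviewers, the paper load is `lam` and the reviewer load is `mu`. -/

/-- A partial assignment: a set of papers, and the two reviewers of each of them (listed in an
arbitrary order). -/
abbrev PartialAssignment (m n : ℕ) : Type := Σ P : Finset (Fin n), (P → Fin m × Fin m)

/-- An assignment: the set of pairs (reviewer, paper) such that the paper is assigned to the
reviewer. -/
abbrev Assignment (m n : ℕ) : Type := Finset (Fin m × Fin n)

/-- The pairs (reviewer, paper) of a partial assignment. -/
def PartialAssignment.pairs {m n : ℕ} (A : PartialAssignment m n) : Assignment m n :=
  Finset.univ.image (fun j : A.1 => ((A.2 j).1, (j : Fin n)))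
    ∪ Finset.univ.image (fun j : A.1 => ((A.2 j).2, (j : Fin n)))

/-- Each paper of the partial assignment has two reviewers from the pool `R`, and no reviewer is
used twice. -/
def PartialAssignment.IsValid {m n : ℕ} (A : PartialAssignment m n) (R : Finset (Fin m)) : Prop :=
  (∀ j, (A.2 j).1 ∈ R ∧ (A.2 j).2 ∈ R) ∧
    Function.Injective (Sum.elim (fun j => (A.2 j).1) (fun j => (A.2 j).2))

/-- `A'` complements the partial assignment `A` when the reviewers in `SB` are single-blind and the
others double-blind: it contains `A`, each paper has `lam` SB and `lam` DB reviewers, and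
each reviewer has at most `mu` papers. -/
def IsComplement (lam mu : ℕ) {m n : ℕ} (SB : Finset (Fin m)) (A : PartialAssignment m n)
    (A' : Assignment m n) : Prop :=
  A.pairs ⊆ A' ∧
  (∀ j, Finset.card {i | i ∈ SB ∧ (i, j) ∈ A'} = lam) ∧
  (∀ j, Finset.card {i | i ∉ SB ∧ (i, j) ∈ A'} = lam) ∧
  (∀ i, Finset.card {j | (i, j) ∈ A'} ≤ mu)

/-- Bids of the reviewers on the papers, with values in an arbitrary type `β`. -/
abbrev Bids (m n : ℕ) (β : Type) : Type := Fin m → Fin n → β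

/-- An arbitrary, possibly randomized, assignment algorithm that sees the bids (and may depend on
any other fixed information, such as similarities). `assign b P R` assigns two reviewers of the
pool `R` to each paper of `P`; `complement b SB A` extends a partial assignment, and respects the
load constraints whenever this can be done. -/
structure AssignmentAlgorithm (lam mu m n : ℕ) (β : Type) where
  assign : Bids m n β → (P : Finset (Fin n)) → Finset (Fin m) → PMF (P → Fin m × Fin m)
  assign_valid : ∀ b P R, R.card = 2 * P.card →
    ∀ a ∈ (assign b P R).support, PartialAssignment.IsValid ⟨P, a⟩ R
  complement : Bids m n β → Finset (Fin m) → PartialAssignment m n → PMF (Assignment m n)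
  complement_extends : ∀ b SB A, ∀ A' ∈ (complement b SB A).support, A.pairs ⊆ A'
  complement_valid : ∀ b SB A, (∃ A', IsComplement lam mu SB A A') →
    ∀ A' ∈ (complement b SB A).support, IsComplement lam mu SB A A'

/-- The difference between the numbers of papers of `P` in `J` and outside `J`. -/
def imbalance {n : ℕ} (J P : Finset (Fin n)) : ℤ :=
  |((P ∩ J).card : ℤ) - ((P \ J).card : ℤ)|

/-- An arbitrary rule for the choice of `m / 2` papers in the case `m < 2 n` such that the shares of
`J` and of its complement among them are as close to each other as possible. -/
structure PaperSelection (m : ℕ) {n : ℕ} (J : Finset (Fin n)) (β : Type) where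
  choose : Bids m n β → PMF (Finset (Fin n))
  card_eq : m < 2 * n → ∀ b, ∀ P ∈ (choose b).support, P.card = m / 2
  balanced : m < 2 * n → ∀ b, ∀ P ∈ (choose b).support,
    ∀ P' : Finset (Fin n), P'.card = m / 2 → imbalance J P ≤ imbalance J P'

/-- The behaviour of the reviewers. When reviewer `i` is single-blind (double-blind) and is assigned
the set of papers `S`, her/his decisions have the joint law `sb i S` (`db i S`). Decisions of one
reviewer may be dependent; only the acceptance probability of each assigned paper is given, by
the matrix `Psb` (`Pdb`). Values at unassigned papers are never used. -/
structure Behaviour {m n : ℕ} (Psb Pdb : Matrix (Fin m) (Fin n) unitInterval) where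
  sb : Fin m → Finset (Fin n) → PMF (Fin n → Bool)
  db : Fin m → Finset (Fin n) → PMF (Fin n → Bool)
  sb_marginal : ∀ i S, ∀ j ∈ S, (sb i S).map (fun v => v j) true = ENNReal.ofReal (Psb i j)
  db_marginal : ∀ i S, ∀ j ∈ S, (db i S).map (fun v => v j) true = ENNReal.ofReal (Pdb i j)

section Procedure

variable {lam mu m n : ℕ} {J : Finset (Fin n)} {β : Type}

/-- The partial assignment `A*`: if `m > 2 n`, on a uniformly random set of `2 n` reviewers; if
`m < 2 n`, on a balanced set of `m / 2` papers; otherwise on all papers and reviewers. -/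
def partialStep (alg : AssignmentAlgorithm lam mu m n β) (sel : PaperSelection m J β)
    (b : Bids m n β) : PMF (PartialAssignment m n) :=
  if h : 2 * n < m then
    (PMF.uniformOfFinset (Finset.powersetCard (2 * n) (Finset.univ : Finset (Fin m)))
      (Finset.powersetCard_nonempty.mpr (by simpa using h.le))).bind fun R =>
        (alg.assign b Finset.univ R).map (Sigma.mk Finset.univ)
  else if m < 2 * n then
    (sel.choose b).bind fun P => (alg.assign b P Finset.univ).map (Sigma.mk P)
  else
    (alg.assign b Finset.univ Finset.univ).map (Sigma.mk Finset.univ)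

/-- The reviewers who do not appear in the partial assignment. -/
def unmatched (A : PartialAssignment m n) : Finset (Fin m) :=
  {i | ∀ j, (A.2 j).1 ≠ i ∧ (A.2 j).2 ≠ i}

/-- The SB reviewer of a paper of the partial assignment, given the coin of each paper. -/
def sbReviewer (A : PartialAssignment m n) (coin : A.1 → Bool) (j : A.1) : Fin m :=
  if coin j then (A.2 j).1 else (A.2 j).2

/-- The DB reviewer of a paper of the partial assignment, given the coin of each paper. -/
def dbReviewer (A : PartialAssignment m n) (coin : A.1 → Bool) (j : A.1) : Fin m :=
  if coin j then (A.2 j).2 else (A.2 j).1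

/-- A fair coin for each paper of the partial assignment decides which of its two reviewers is SB. -/
def coinStep (A : PartialAssignment m n) : PMF (A.1 → Bool) :=
  PMF.uniformOfFintype (A.1 → Bool)

/-- A uniformly random half of the remaining reviewers is allocated to SB. -/
def restStep (A : PartialAssignment m n) : PMF (Finset (Fin m)) :=
  PMF.uniformOfFinset (Finset.powersetCard ((unmatched A).card / 2) (unmatched A))
    (Finset.powersetCard_nonempty.mpr (Nat.div_le_self _ _))

/-- The set of all SB reviewers. -/
def sbSet (A : PartialAssignment m n) (coin : A.1 → Bool) (H : Finset (Fin m)) :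
    Finset (Fin m) :=
  Finset.univ.image (sbReviewer A coin) ∪ H

/-- The papers of reviewer `i` in an assignment. -/
def papersOf (A' : Assignment m n) (i : Fin m) : Finset (Fin n) :=
  {j | (i, j) ∈ A'}

/-- The review process: reviewers act independently of each other. -/
def reviewStep {Psb Pdb : Matrix (Fin m) (Fin n) unitInterval} (beh : Behaviour Psb Pdb)
    (SB : Finset (Fin m)) (A' : Assignment m n) : PMF (Fin m → Fin n → Bool) :=
  independent fun i => if i ∈ SB then beh.sb i (papersOf A' i) else beh.db i (papersOf A' i)

/-- The set of tuples `T`: for each paper of the partial assignment, the decisions of its SB and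
DB reviewers and the indicator of `J`. -/
def tuples (J : Finset (Fin n)) (A : PartialAssignment m n) (coin : A.1 → Bool)
    (vote : Fin m → Fin n → Bool) : TupleSet n :=
  ⟨A.1, fun j =>
    { paper := j
      Y := vote (sbReviewer A coin j) j
      X := vote (dbReviewer A coin j) j
      w := if (j : Fin n) ∈ J then 1 else -1 }⟩

/-- The whole procedure, as the law of the set of tuples handed to the test. The law of the (blind)
bids is fixed before the reviewers are allocated to conditions. -/
def procedure (bidLaw : PMF (Bids m n β)) (alg : AssignmentAlgorithm lam mu m n β)
    (sel : PaperSelection m J β) {Psb Pdb : Matrix (Fin m) (Fin n) unitInterval}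
    (beh : Behaviour Psb Pdb) : PMF (TupleSet n) :=
  bidLaw.bind fun b =>
    (partialStep alg sel b).bind fun A =>
      (coinStep A).bind fun coin =>
        (restStep A).bind fun H =>
          (alg.complement b (sbSet A coin H) A).bind fun A' =>
            (reviewStep beh (sbSet A coin H) A').map (tuples J A coin)

end Procedure

/-! ### The relative bias problem -/

/-- The null hypothesis with function `f`. -/
def NullHypothesis {m n : ℕ} (f : ℝ → ℝ) (Psb Pdb : Matrix (Fin m) (Fin n) unitInterval) : Prop :=
  ∀ i j, (Psb i j : ℝ) = f (Pdb i j)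

/-- The alternative hypothesis (bias in favour of the papers in `J`) with function `f`, all of whose
inequalities hold with margin `δ`. -/
def AlternativeWithMargin {m n : ℕ} (J : Finset (Fin n)) (f : ℝ → ℝ) (δ : ℝ)
    (Psb Pdb : Matrix (Fin m) (Fin n) unitInterval) : Prop :=
  (∀ i j, (j ∈ J → f (Pdb i j) ≤ Psb i j) ∧ (j ∉ J → (Psb i j : ℝ) ≤ f (Pdb i j))) ∧
    ∀ i j, δ < |(Psb i j : ℝ) - f (Pdb i j)|

/-- A test: for each number of papers, the sets of tuples for which it rejects. -/
abbrev Test : Type := ∀ n : ℕ, TupleSet n → Prop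

/-- A model of the DB reviewers: the admissible matrices of acceptance probabilities. -/
abbrev DBModel : Type := ∀ m n : ℕ, Matrix (Fin m) (Fin n) unitInterval → Prop

/-- The test, run on the outcome of the procedure, has Type-I error at most `α`, uniformly over all
conferences, reviewer behaviours with a DB matrix of the model, and functions of the class `F`. -/
def ControlsTypeIError (lam mu : ℕ) (model : DBModel) (F : Set (ℝ → ℝ)) (test : Test) (α : ℝ) :
    Prop :=
  ∀ (m n : ℕ), Even m → ∀ (J : Finset (Fin n)) (β : Type)
    (bidLaw : PMF (Bids m n β)) (alg : AssignmentAlgorithm lam mu m n β)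
    (sel : PaperSelection m J β) (Psb Pdb : Matrix (Fin m) (Fin n) unitInterval)
    (beh : Behaviour Psb Pdb),
    model m n Pdb → ∀ f ∈ F, NullHypothesis f Psb Pdb →
      (procedure bidLaw alg sel beh).toOuterMeasure {T | test n T} ≤ ENNReal.ofReal α

/-- Non-trivial power: for all `ε, δ > 0` there is `n₀` such that, if both `J` and its complement have
more than `n₀` papers, every alternative with margin `δ`, for a bias in favour of `J` or against
`J`, is detected with probability at least `1 - ε`. The inequality `2 * lam * n ≤ mu * m` says that
the reviewers have enough capacity for the required number of reviews. -/
def HasNontrivialPower (lam mu : ℕ) (model : DBModel) (F : Set (ℝ → ℝ)) (test : Test) : Prop :=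
  ∀ ε > (0 : ℝ), ∀ δ > (0 : ℝ), ∃ n₀ : ℕ,
    ∀ (m n : ℕ), Even m → 2 * lam * n ≤ mu * m →
    ∀ (J : Finset (Fin n)), n₀ < min J.card Jᶜ.card → ∀ (β : Type)
      (bidLaw : PMF (Bids m n β)) (alg : AssignmentAlgorithm lam mu m n β)
      (sel : PaperSelection m J β) (Psb Pdb : Matrix (Fin m) (Fin n) unitInterval)
      (beh : Behaviour Psb Pdb),
      model m n Pdb → ∀ f ∈ F,
        (AlternativeWithMargin J f δ Psb Pdb ∨ AlternativeWithMargin Jᶜ f δ Psb Pdb) →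
        ENNReal.ofReal (1 - ε) ≤ (procedure bidLaw alg sel beh).toOuterMeasure {T | test n T}

/-! ### The generalized linear and the generalized logistic model -/

/-- Generalized linear model of the DB reviewers: the acceptance probability is the representation
`q j ∈ (Δ, 1 - Δ)` of the paper. -/
def linearDBModel (Δ : ℝ) : DBModel := fun _ n Pdb =>
  ∃ q : Fin n → ℝ, (∀ j, q j ∈ Set.Ioo Δ (1 - Δ)) ∧ ∀ i j, (Pdb i j : ℝ) = q j

/-- The functions `t ↦ t + ν`, `ν ∈ (-Δ, Δ)` (used on `(Δ, 1 - Δ)` only). -/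
def linearClass (Δ : ℝ) : Set (ℝ → ℝ) :=
  {f | ∃ ν ∈ Set.Ioo (-Δ) Δ, f = fun t => t + ν}

/-- Generalized logistic model of the DB reviewers: the log-odds of acceptance are
`b0 + b1 * q j`. -/
def logisticDBModel (Δ : ℝ) : DBModel := fun _ n Pdb =>
  ∃ (b0 b1 : ℝ) (q : Fin n → ℝ), |b0| ≤ Δ ∧ |b1| ≤ Δ ∧ 0 < b1 ∧
    (∀ j, q j ∈ Set.Ioo (-Δ) Δ) ∧
    ∀ i j, (Pdb i j : ℝ) ∈ Set.Ioo (0 : ℝ) 1 ∧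
      Real.log ((Pdb i j : ℝ) / (1 - (Pdb i j : ℝ))) = b0 + b1 * q j

/-- The functions `t ↦ t e^ν / (1 - t + t e^ν)`, `ν ∈ (-Δ, Δ)`: the shifts of the log-odds
by `ν`. -/
def logisticClass (Δ : ℝ) : Set (ℝ → ℝ) :=
  {f | ∃ ν ∈ Set.Ioo (-Δ) Δ, f = fun t => t * Real.exp ν / (1 - t + t * Real.exp ν)}

end BiasTest

end

namespace BiasTest

open MeasureTheory ProbabilityTheory

/-! ### Auxiliary facts on finitely supported laws -/

/-! All bounds are proved conditionally on the bids, `A*`, the coins, the random half and the full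
assignment; a bound valid for every outcome of these stages survives averaging. Given them, the
decisions entering the tuples come from pairwise distinct reviewers, so they are independent, with
acceptance probabilities read off `Psb` and `Pdb` (`exists_law_tuples`). Dependence within one
reviewer and the choice of algorithm become irrelevant.

Counting test: the statistic is a linear contrast whose coefficients sum to zero and whose squared
coefficients sum to `1/|U| + 1/|V|`. Under the null every `Y - X` has the same mean `ν`, so the
contrast is centred and Hoeffding's inequality gives `α/2` per tail. Under the alternative its mean
is at least `2δ` in absolute value, while threshold and fluctuations are at most `δ` for large
arrays.

Disagreement test: under the null the odds of the SB and DB decisions have the same ratio `e^ν` for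
every paper. Given which pairs disagree, the SB decisions of those pairs are therefore exchangeable,
and a permutation test is exact up to ties and rounding (`sum_randomization_test_le`). For power,
Hoeffding's inequality separates the two means around `θ = e^ν/(1 + e^ν)`, the common null
acceptance probability given disagreement, and Chebyshev's inequality for a random permutation
(`permutationPValue_le`) makes the p-value small.

Power also needs both arrays to be large: the reviewers' capacity forces `m` to be large, and
balance then forces many selected papers of both kinds (`exists_le_card_of_isSelection`). -/

theorem toOuterMeasure_bind_le {γ δ : Type} (p : PMF γ) (f : γ → PMF δ) (s : Set δ) (c : ℝ≥0∞)
    (h : ∀ a ∈ p.support, (f a).toOuterMeasure s ≤ c) : (p.bind f).toOuterMeasure s ≤ c := by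
  rw [PMF.toOuterMeasure_bind_apply]
  calc ∑' a, p a * (f a).toOuterMeasure s ≤ ∑' a, p a * c := by
        refine ENNReal.tsum_le_tsum fun a => ?_
        by_cases ha : a ∈ p.support
        · exact mul_le_mul_right (h a ha) _
        · simp [(p.apply_eq_zero_iff a).2 ha]
    _ = c := by rw [ENNReal.tsum_mul_right, p.tsum_coe, one_mul]

theorem le_toOuterMeasure_bind {γ δ : Type} (p : PMF γ) (f : γ → PMF δ) (s : Set δ) (c : ℝ≥0∞)
    (h : ∀ a ∈ p.support, c ≤ (f a).toOuterMeasure s) : c ≤ (p.bind f).toOuterMeasure s := by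
  rw [PMF.toOuterMeasure_bind_apply]
  calc c = ∑' a, p a * c := by rw [ENNReal.tsum_mul_right, p.tsum_coe, one_mul]
    _ ≤ ∑' a, p a * (f a).toOuterMeasure s := by
        refine ENNReal.tsum_le_tsum fun a => ?_
        by_cases ha : a ∈ p.support
        · exact mul_le_mul_right (h a ha) _
        · simp [(p.apply_eq_zero_iff a).2 ha]

theorem independent_apply {ι γ : Type} [Fintype ι] [DecidableEq ι] [Fintype γ] (p : ι → PMF γ)
    (x : ι → γ) : independent p x = ∏ i, p i (x i) := rfl

/-- Functions of distinct coordinates of an independent family are independent. -/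
theorem independent_map_comp {ι κ γ δ : Type} [Fintype ι] [DecidableEq ι] [Fintype γ]
    [Fintype κ] [DecidableEq κ] [Fintype δ]
    (p : ι → PMF γ) (e : κ → ι) (he : Function.Injective e) (g : κ → γ → δ) :
    (independent p).map (fun v k => g k (v (e k))) =
      independent fun k => (p (e k)).map (g k) := by
  classical
  ext c
  rw [PMF.map_apply, tsum_fintype, independent_apply]
  -- The event that the image equals `c` factors over the coordinates of `v`; `h i` collects the
  -- constraints on coordinate `i`. By injectivity of `e` there is at most one per coordinate, and
  -- an unconstrained coordinate contributes total mass 1.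
  let h : ι → γ → ℝ≥0∞ := fun i a => ∏ k with e k = i, if c k = g k a then 1 else 0
  have h1 : ∀ v : ι → γ, (if c = fun k => g k (v (e k)) then independent p v else 0) =
      ∏ i, (p i (v i) * h i (v i)) := by
    intro v
    have h2 : ∏ i, h i (v i) = ∏ k, if c k = g k (v (e k)) then (1 : ℝ≥0∞) else 0 := by
      rw [← Finset.prod_fiberwise (s := Finset.univ) (g := e)]
      refine Finset.prod_congr rfl fun i _ => Finset.prod_congr rfl fun k hk => ?_
      rw [(Finset.mem_filter.1 hk).2]
    rw [Finset.prod_mul_distrib, h2, Finset.prod_ite_zero, independent_apply]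
    simp only [funext_iff, Finset.mem_univ, true_imp_iff, Finset.prod_const_one]
    split_ifs <;> simp
  refine (Finset.sum_congr rfl fun v _ => (by convert h1 v)).trans ?_
  have h3 := Finset.prod_univ_sum (fun _ : ι => (Finset.univ : Finset γ))
    (fun i a => p i a * h i a)
  rw [Fintype.piFinset_univ] at h3
  rw [← h3, ← Finset.prod_subset (Finset.subset_univ (Finset.univ.image e)),
    Finset.prod_image he.injOn]
  · refine Finset.prod_congr rfl fun k _ => ?_
    rw [PMF.map_apply, tsum_fintype]
    refine Finset.sum_congr rfl fun a _ => ?_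
    have : (Finset.univ.filter fun k' => e k' = e k) = {k} := by
      ext k'; simp [he.eq_iff]
    simp [h, this]
  · intro i _ hi
    have : (Finset.univ.filter fun k => e k = i) = ∅ := by
      ext k; simpa using fun hk => hi (Finset.mem_image.2 ⟨k, Finset.mem_univ _, hk⟩)
    have h4 := (p i).tsum_coe
    rw [tsum_fintype] at h4
    simpa [h, this] using h4

/-- The joint law of two independent decisions. -/
noncomputable def pairLaw (u v : PMF Bool) : PMF (Bool × Bool) :=
  u.bind fun y => v.map (Prod.mk y)

theorem pairLaw_apply (u v : PMF Bool) (y x : Bool) : pairLaw u v (y, x) = u y * v x := by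
  rw [pairLaw, PMF.bind_apply, tsum_bool]
  cases y <;> simp [PMF.map_apply]

theorem independent_sum_map_pair {κ : Type} [Fintype κ] [DecidableEq κ] (u v : κ → PMF Bool) :
    (independent (Sum.elim u v)).map (fun c k => (c (Sum.inl k), c (Sum.inr k))) =
      independent fun k => pairLaw (u k) (v k) := by
  classical
  ext c
  rw [PMF.map_apply, tsum_eq_single (Sum.elim (fun k => (c k).1) fun k => (c k).2)]
  · simp [independent_apply, ← Finset.prod_mul_distrib, ← pairLaw_apply _ _ (c _).1 (c _).2]
  · intro d hd
    rw [if_neg]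
    rintro rfl
    exact hd (by ext (k | k) <;> rfl)

theorem toMeasure_independent {κ γ : Type} [Fintype κ] [DecidableEq κ] [Fintype γ]
    [MeasurableSpace γ] [MeasurableSingletonClass γ] (r : κ → PMF γ) :
    (independent r).toMeasure = Measure.pi fun k => (r k).toMeasure := by
  refine Measure.ext_of_singleton fun x => ?_
  rw [PMF.toMeasure_apply_singleton _ _ (measurableSet_singleton _), Measure.pi_singleton,
    independent_apply]
  exact Finset.prod_congr rfl fun k _ =>
    (PMF.toMeasure_apply_singleton _ _ (measurableSet_singleton _)).symm

/-- Hoeffding's inequality for weighted sums of functions of the coordinates. -/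
theorem independent_hoeffding {κ γ : Type} [Fintype κ] [DecidableEq κ] [Fintype γ]
    (r : κ → PMF γ) (z : κ → γ → ℝ) (hz : ∀ k a, |z k a| ≤ 1) (c : κ → ℝ) {t : ℝ} (ht : 0 ≤ t) :
    (independent r).toOuterMeasure
      {x | t ≤ ∑ k, c k * (z k (x k) - ∑ a, (r k a).toReal * z k a)} ≤
        ENNReal.ofReal (Real.exp (-t ^ 2 / (2 * ∑ k, c k ^ 2))) := by
  let _ : MeasurableSpace γ := ⊤
  have hind : iIndepFun (fun k (x : κ → γ) => c k * (z k (x k) - ∑ a, (r k a).toReal * z k a))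
      (independent r).toMeasure := by
    rw [toMeasure_independent]
    exact iIndepFun_pi (X := fun k a => c k * (z k a - ∑ a, (r k a).toReal * z k a))
      fun k => (measurable_of_finite _).aemeasurable
  -- A variable in `[-1, 1]` has variance proxy `((1 - (-1)) / 2)^2 = 1`; scaling by `c k`
  -- multiplies it by `c k ^ 2`.
  have hsub : ∀ k ∈ Finset.univ, HasSubgaussianMGF
      (fun x : κ → γ => c k * (z k (x k) - ∑ a, (r k a).toReal * z k a))
      (⟨c k ^ 2, sq_nonneg _⟩ * (‖(1 : ℝ) - (-1)‖₊ / 2) ^ 2) (independent r).toMeasure := by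
    intro k _
    have h1 : ∫ x, z k (x k) ∂(independent r).toMeasure = ∑ a, (r k a).toReal * z k a := by
      rw [toMeasure_independent, integral_comp_eval (f := z k) (μ := fun k => (r k).toMeasure)
        (measurable_of_finite _).aestronglyMeasurable, PMF.integral_eq_sum]
      simp
    have h2 := hasSubgaussianMGF_of_mem_Icc (μ := (independent r).toMeasure)
      (X := fun x => z k (x k)) (a := -1) (b := 1) (measurable_of_finite _).aemeasurable
      (Filter.Eventually.of_forall fun x => abs_le.1 (hz k (x k)))
    rw [h1] at h2
    exact h2.const_mul (c k)
  have h := HasSubgaussianMGF.measure_sum_ge_le_of_iIndepFun hind hsub ht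
  have h3 : (independent r).toOuterMeasure
      {x | t ≤ ∑ k, c k * (z k (x k) - ∑ a, (r k a).toReal * z k a)} =
      (independent r).toMeasure
      {x | t ≤ ∑ k, c k * (z k (x k) - ∑ a, (r k a).toReal * z k a)} :=
    (PMF.toMeasure_apply_eq_toOuterMeasure_apply _ (Set.toFinite _).measurableSet).symm
  rw [h3, ← ENNReal.ofReal_toReal (measure_ne_top _ _)]
  refine ENNReal.ofReal_le_ofReal (h.trans (le_of_eq ?_))
  congr 3
  push_cast
  refine Finset.sum_congr rfl fun k _ => ?_
  norm_num
  exact mul_one (c k ^ 2)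

/-! ### The law of the tuples given the assignment and the conditions -/

/-- The set of tuples with given decisions for each paper of `P`. -/
def pairTuples {n : ℕ} (J P : Finset (Fin n)) (x : P → Bool × Bool) : TupleSet n :=
  ⟨P, fun j =>
    { paper := j
      Y := (x j).1
      X := (x j).2
      w := if (j : Fin n) ∈ J then 1 else -1 }⟩

section

variable {lam mu m n : ℕ} {J : Finset (Fin n)} {β : Type}

theorem reviewer_injective {A : PartialAssignment m n} {R : Finset (Fin m)} (hA : A.IsValid R)
    (coin : A.1 → Bool) :
    Function.Injective (Sum.elim (sbReviewer A coin) (dbReviewer A coin)) := by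
  -- The coins only exchange the two reviewers within papers, which is an injective relabelling of
  -- the slots.
  let s : A.1 ⊕ A.1 → A.1 ⊕ A.1 := fun k => k.elim
    (fun j => if coin j then Sum.inl j else Sum.inr j)
    (fun j => if coin j then Sum.inr j else Sum.inl j)
  have hs : Function.Injective s := by
    rintro (j | j) (k | k) h <;> simp only [s, Sum.elim_inl, Sum.elim_inr] at h <;>
      split_ifs at h <;> simp_all
  have : Sum.elim (sbReviewer A coin) (dbReviewer A coin) =
      Sum.elim (fun j => (A.2 j).1) (fun j => (A.2 j).2) ∘ s := by
    ext (j | j) <;> by_cases h : coin j <;> simp [s, sbReviewer, dbReviewer, h]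
  rw [this]
  exact hA.2.comp hs

theorem sbReviewer_mem_sbSet (A : PartialAssignment m n) (coin : A.1 → Bool) (H : Finset (Fin m))
    (j : A.1) : sbReviewer A coin j ∈ sbSet A coin H :=
  Finset.mem_union_left _ (Finset.mem_image_of_mem _ (Finset.mem_univ _))

theorem dbReviewer_notMem_sbSet {A : PartialAssignment m n} {R : Finset (Fin m)}
    (hA : A.IsValid R) (coin : A.1 → Bool) {H : Finset (Fin m)} (hH : H ⊆ unmatched A)
    (j : A.1) : dbReviewer A coin j ∉ sbSet A coin H := by
  intro h
  rcases Finset.mem_union.1 h with h | h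
  · obtain ⟨k, -, hk⟩ := Finset.mem_image.1 h
    have := @reviewer_injective _ _ _ _ hA coin (Sum.inl k) (Sum.inr j) hk
    simp at this
  · have h1 := (Finset.mem_filter.1 (hH h)).2 j
    unfold dbReviewer at h1
    split_ifs at h1
    · exact h1.2 rfl
    · exact h1.1 rfl

theorem mem_pairs (A : PartialAssignment m n) (j : A.1) :
    ((A.2 j).1, (j : Fin n)) ∈ A.pairs ∧ ((A.2 j).2, (j : Fin n)) ∈ A.pairs :=
  ⟨Finset.mem_union_left _ (Finset.mem_image_of_mem (fun j : A.1 => ((A.2 j).1, (j : Fin n)))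
      (Finset.mem_univ j)),
    Finset.mem_union_right _ (Finset.mem_image_of_mem (fun j : A.1 => ((A.2 j).2, (j : Fin n)))
      (Finset.mem_univ j))⟩

theorem mem_papersOf_sbReviewer {A : PartialAssignment m n} (coin : A.1 → Bool)
    {A' : Assignment m n} (h : A.pairs ⊆ A') (j : A.1) :
    (j : Fin n) ∈ papersOf A' (sbReviewer A coin j) := by
  refine Finset.mem_filter.2 ⟨Finset.mem_univ _, ?_⟩
  unfold sbReviewer
  split_ifs
  exacts [h (mem_pairs A j).1, h (mem_pairs A j).2]

theorem mem_papersOf_dbReviewer {A : PartialAssignment m n} (coin : A.1 → Bool)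
    {A' : Assignment m n} (h : A.pairs ⊆ A') (j : A.1) :
    (j : Fin n) ∈ papersOf A' (dbReviewer A coin j) := by
  refine Finset.mem_filter.2 ⟨Finset.mem_univ _, ?_⟩
  unfold dbReviewer
  split_ifs
  exacts [h (mem_pairs A j).2, h (mem_pairs A j).1]

/-- Given the assignment and the conditions, the decisions that enter the tuples are
independent. -/
theorem exists_law_tuples {Psb Pdb : Matrix (Fin m) (Fin n) unitInterval}
    (beh : Behaviour Psb Pdb) {A : PartialAssignment m n} {R : Finset (Fin m)} (hA : A.IsValid R)
    (coin : A.1 → Bool) {H : Finset (Fin m)} (hH : H ⊆ unmatched A) {A' : Assignment m n}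
    (hA' : A.pairs ⊆ A') :
    ∃ u v : A.1 → PMF Bool,
      (∀ j, u j true = ENNReal.ofReal (Psb (sbReviewer A coin j) j)) ∧
      (∀ j, v j true = ENNReal.ofReal (Pdb (dbReviewer A coin j) j)) ∧
      (reviewStep beh (sbSet A coin H) A').map (tuples J A coin) =
        (independent fun k => pairLaw (u k) (v k)).map (pairTuples J A.1) := by
  refine ⟨fun j => (beh.sb (sbReviewer A coin j) (papersOf A' (sbReviewer A coin j))).map
      fun v => v j,
    fun j => (beh.db (dbReviewer A coin j) (papersOf A' (dbReviewer A coin j))).map fun v => v j,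
    fun j => beh.sb_marginal _ _ _ (mem_papersOf_sbReviewer coin hA' j),
    fun j => beh.db_marginal _ _ _ (mem_papersOf_dbReviewer coin hA' j), ?_⟩
  -- Each slot reads one coordinate of one reviewer's vote. The joint law of that vote depends on
  -- all papers of the reviewer, but this coordinate's marginal does not.
  have h := independent_map_comp (fun i => if i ∈ sbSet A coin H
      then beh.sb i (papersOf A' i) else beh.db i (papersOf A' i)) _ (reviewer_injective hA coin)
      (Sum.elim (fun j (v : Fin n → Bool) => v j) (fun j v => v j))
  rw [← independent_sum_map_pair, PMF.map_comp]
  have h2 : (fun k : A.1 ⊕ A.1 => (if Sum.elim (sbReviewer A coin) (dbReviewer A coin) k ∈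
        sbSet A coin H then beh.sb (Sum.elim (sbReviewer A coin) (dbReviewer A coin) k)
          (papersOf A' (Sum.elim (sbReviewer A coin) (dbReviewer A coin) k))
        else beh.db (Sum.elim (sbReviewer A coin) (dbReviewer A coin) k)
          (papersOf A' (Sum.elim (sbReviewer A coin) (dbReviewer A coin) k))).map
        (Sum.elim (fun (j : A.1) (v : Fin n → Bool) => v j) (fun (j : A.1) v => v j) k)) =
      Sum.elim
        (fun j => (beh.sb (sbReviewer A coin j) (papersOf A' (sbReviewer A coin j))).map
          fun v => v j)
        (fun j => (beh.db (dbReviewer A coin j) (papersOf A' (dbReviewer A coin j))).map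
          fun v => v j) := by
    ext1 (j | j)
    · simp [sbReviewer_mem_sbSet]
    · simp [dbReviewer_notMem_sbSet hA coin hH]
  rw [← h2, ← h, PMF.map_comp]
  rfl

/-- The papers selected by the procedure. -/
def IsSelection (m : ℕ) {n : ℕ} (J P : Finset (Fin n)) : Prop :=
  P = Finset.univ ∨ P.card = m / 2 ∧
    ∀ P' : Finset (Fin n), P'.card = m / 2 → imbalance J P ≤ imbalance J P'

theorem partialStep_support (hm : Even m) (alg : AssignmentAlgorithm lam mu m n β)
    (sel : PaperSelection m J β) (b : Bids m n β) (A : PartialAssignment m n)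
    (hA : A ∈ (partialStep alg sel b).support) :
    IsSelection m J A.1 ∧ ∃ R, A.IsValid R := by
  unfold partialStep at hA
  split_ifs at hA with h1 h2
  · simp only [PMF.mem_support_bind_iff, PMF.mem_support_uniformOfFinset_iff,
      Finset.mem_powersetCard, PMF.mem_support_map_iff] at hA
    obtain ⟨R, hR, a, ha, rfl⟩ := hA
    exact ⟨Or.inl rfl, R, alg.assign_valid b _ R (by simpa using hR.2) a ha⟩
  · simp only [PMF.mem_support_bind_iff, PMF.mem_support_map_iff] at hA
    obtain ⟨P, hP, a, ha, rfl⟩ := hA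
    have hc := sel.card_eq h2 b P hP
    refine ⟨Or.inr ⟨hc, sel.balanced h2 b P hP⟩, _, alg.assign_valid b P _ ?_ a ha⟩
    -- Evenness makes `2 * (m / 2) = m`, so the full pool has exactly the size that the assignment
    -- requires.
    obtain ⟨r, rfl⟩ := hm
    rw [hc, Finset.card_univ, Fintype.card_fin]
    omega
  · simp only [PMF.mem_support_map_iff] at hA
    obtain ⟨a, ha, rfl⟩ := hA
    refine ⟨Or.inl rfl, _, alg.assign_valid b _ _ ?_ a ha⟩
    simp only [Finset.card_univ, Fintype.card_fin]
    omega

theorem restStep_support {A : PartialAssignment m n} {H : Finset (Fin m)}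
    (hH : H ∈ (restStep A).support) : H ⊆ unmatched A := by
  rw [restStep, PMF.mem_support_uniformOfFinset_iff, Finset.mem_powersetCard] at hH
  exact hH.1

/-- An upper bound on the probability of an event that holds given the assignment and the
conditions. -/
theorem procedure_toOuterMeasure_le (hm : Even m) (bidLaw : PMF (Bids m n β))
    (alg : AssignmentAlgorithm lam mu m n β) (sel : PaperSelection m J β)
    {Psb Pdb : Matrix (Fin m) (Fin n) unitInterval} (beh : Behaviour Psb Pdb)
    (S : Set (TupleSet n)) (c : ℝ≥0∞)
    (h : ∀ (P : Finset (Fin n)) (rs rd : P → Fin m) (u v : P → PMF Bool),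
      (∀ j, u j true = ENNReal.ofReal (Psb (rs j) j)) →
      (∀ j, v j true = ENNReal.ofReal (Pdb (rd j) j)) →
      (independent fun k => pairLaw (u k) (v k)).toOuterMeasure (pairTuples J P ⁻¹' S) ≤ c) :
    (procedure bidLaw alg sel beh).toOuterMeasure S ≤ c := by
  refine toOuterMeasure_bind_le _ _ _ _ fun b _ => toOuterMeasure_bind_le _ _ _ _ fun A hA =>
    toOuterMeasure_bind_le _ _ _ _ fun coin _ => toOuterMeasure_bind_le _ _ _ _ fun H hH =>
    toOuterMeasure_bind_le _ _ _ _ fun A' hA' => ?_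
  obtain ⟨-, R, hR⟩ := partialStep_support hm alg sel b A hA
  obtain ⟨u, v, hu, hv, huv⟩ := exists_law_tuples (J := J) beh hR coin (restStep_support hH)
    (alg.complement_extends _ _ _ A' hA')
  rw [huv, PMF.toOuterMeasure_map_apply]
  exact h A.1 _ _ u v hu hv

/-- A lower bound on the probability of an event that holds given the assignment and the
conditions. -/
theorem le_procedure_toOuterMeasure (hm : Even m) (bidLaw : PMF (Bids m n β))
    (alg : AssignmentAlgorithm lam mu m n β) (sel : PaperSelection m J β)
    {Psb Pdb : Matrix (Fin m) (Fin n) unitInterval} (beh : Behaviour Psb Pdb)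
    (S : Set (TupleSet n)) (c : ℝ≥0∞)
    (h : ∀ (P : Finset (Fin n)) (rs rd : P → Fin m) (u v : P → PMF Bool), IsSelection m J P →
      (∀ j, u j true = ENNReal.ofReal (Psb (rs j) j)) →
      (∀ j, v j true = ENNReal.ofReal (Pdb (rd j) j)) →
      c ≤ (independent fun k => pairLaw (u k) (v k)).toOuterMeasure (pairTuples J P ⁻¹' S)) :
    c ≤ (procedure bidLaw alg sel beh).toOuterMeasure S := by
  refine le_toOuterMeasure_bind _ _ _ _ fun b _ => le_toOuterMeasure_bind _ _ _ _ fun A hA =>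
    le_toOuterMeasure_bind _ _ _ _ fun coin _ => le_toOuterMeasure_bind _ _ _ _ fun H hH =>
    le_toOuterMeasure_bind _ _ _ _ fun A' hA' => ?_
  obtain ⟨hP, R, hR⟩ := partialStep_support hm alg sel b A hA
  obtain ⟨u, v, hu, hv, huv⟩ := exists_law_tuples (J := J) beh hR coin (restStep_support hH)
    (alg.complement_extends _ _ _ A' hA')
  rw [huv, PMF.toOuterMeasure_map_apply]
  exact h A.1 _ _ u v hP hu hv

end

/-! ### Balanced selections -/

/-- Exchange argument: otherwise some paper of `J` is unselected and `P \ J` exceeds `P ∩ J` by at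
least two, so swapping one paper of `P \ J` for it lowers the imbalance by two. -/
theorem min_le_card_inter {n k : ℕ} {J P : Finset (Fin n)} (hk : P.card = k)
    (hb : ∀ P' : Finset (Fin n), P'.card = k → imbalance J P ≤ imbalance J P') :
    min J.card (k / 2) ≤ (P ∩ J).card := by
  by_contra! hlt
  have hJ : (P ∩ J).card < J.card := hlt.trans_le (min_le_left _ _)
  have hk2 : (P ∩ J).card < k / 2 := hlt.trans_le (min_le_right _ _)
  have hsum := Finset.card_inter_add_card_sdiff P J
  obtain ⟨x, hxJ, hxP⟩ : ∃ x ∈ J, x ∉ P := by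
    by_contra! h
    exact hJ.ne (by rw [Finset.inter_eq_right.2 h])
  obtain ⟨y, hy⟩ : (P \ J).Nonempty := by
    rw [← Finset.card_pos]; omega
  obtain ⟨hyP, hyJ⟩ := Finset.mem_sdiff.1 hy
  have hxy : x ∉ P.erase y := fun h => hxP (Finset.mem_of_mem_erase h)
  have hinter : insert x (P.erase y) ∩ J = insert x (P ∩ J) := by
    ext a
    simp only [Finset.mem_inter, Finset.mem_insert, Finset.mem_erase]
    grind
  have hsdiff : insert x (P.erase y) \ J = (P \ J).erase y := by
    ext a
    simp only [Finset.mem_sdiff, Finset.mem_insert, Finset.mem_erase]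
    grind
  have h := hb (insert x (P.erase y)) (by
    rw [Finset.card_insert_of_notMem hxy, Finset.card_erase_add_one hyP, hk])
  have h1 : (insert x (P ∩ J)).card = (P ∩ J).card + 1 :=
    Finset.card_insert_of_notMem fun h => hxP (Finset.mem_inter.1 h).1
  have h2 : ((P \ J).erase y).card = (P \ J).card - 1 := Finset.card_erase_of_mem hy
  unfold imbalance at h
  rw [hinter, hsdiff, h1, h2] at h
  rw [abs_of_nonpos (by omega), abs_of_nonpos (by omega)] at h
  omega

theorem imbalance_compl {n : ℕ} (J P : Finset (Fin n)) : imbalance Jᶜ P = imbalance J P := by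
  rw [imbalance, imbalance, abs_sub_comm, ← Finset.sdiff_eq_inter_compl]
  simp [Finset.sdiff_eq_inter_compl]

/-- If there are many papers inside and outside `J`, many of both kinds are selected. -/
theorem exists_le_card_of_isSelection {lam mu : ℕ} (hlam : 1 ≤ lam) (N : ℕ) :
    ∃ n₀ : ℕ, ∀ (m n : ℕ), 2 * lam * n ≤ mu * m → Even m → ∀ J P : Finset (Fin n),
      n₀ < min J.card Jᶜ.card → IsSelection m J P → N ≤ (P ∩ J).card ∧ N ≤ (P \ J).card := by
  -- The summand `N` makes `J` and its complement large enough. The other one excludes `m < 4 * N`,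
  -- which would give `2|J| ≤ 2n ≤ 2 * lam * n ≤ mu * m ≤ 4 * mu * N`.
  refine ⟨2 * mu * (N + 1) + N, fun m n hmn hm J P hn hP => ?_⟩
  rw [lt_min_iff] at hn
  rcases hP with rfl | ⟨hc, hb⟩
  · rw [Finset.univ_inter, ← Finset.compl_eq_univ_sdiff]
    have : N ≤ 2 * mu * (N + 1) + N := by omega
    omega
  have hNm : N ≤ m / 2 / 2 := by
    by_contra! h
    have h1 : m < 4 * N := by omega
    have h2 : J.card ≤ n := by simpa using J.card_le_univ
    have h3 : n ≤ lam * n := Nat.le_mul_of_pos_left _ hlam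
    have h4 : mu * m ≤ mu * (4 * N) := Nat.mul_le_mul_left _ h1.le
    nlinarith
  have h1 := min_le_card_inter hc hb
  have h2 := min_le_card_inter (J := Jᶜ) hc (by simpa only [imbalance_compl] using hb)
  rw [← Finset.sdiff_eq_inter_compl] at h2
  have h3 : N ≤ J.card := by omega
  have h4 : N ≤ Jᶜ.card := by omega
  exact ⟨(le_min h3 hNm).trans h1, (le_min h4 hNm).trans h2⟩

/-! ### The difference of the means as a linear statistic -/

section

variable {κ κ' : Type} [Fintype κ] [Fintype κ']

/-- The coefficients of the linear statistic `meanGap w`. -/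
noncomputable def gapCoeff (w : κ → ℤ) (k : κ) : ℝ :=
  (if w k = 1 then ((Finset.card {k | w k = 1} : ℝ))⁻¹ else 0)
    - (if w k = -1 then ((Finset.card {k | w k = -1} : ℝ))⁻¹ else 0)

theorem meanGap_eq_sum (w : κ → ℤ) (z : κ → ℝ) : meanGap w z = ∑ k, gapCoeff w k * z k := by
  simp only [meanGap, gapCoeff, sub_mul, Finset.sum_sub_distrib, ite_mul, zero_mul,
    ← Finset.sum_filter, ← Finset.mul_sum, div_eq_inv_mul]

theorem sum_gapCoeff (w : κ → ℤ) (h1 : ∃ k, w k = 1) (h2 : ∃ k, w k = -1) :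
    ∑ k, gapCoeff w k = 0 := by
  have h := meanGap_eq_sum w fun _ => 1
  obtain ⟨k, hk⟩ := h1
  obtain ⟨l, hl⟩ := h2
  have h3 : (Finset.card {k | w k = 1} : ℝ) ≠ 0 := by
    rw [Nat.cast_ne_zero]; exact Finset.card_ne_zero_of_mem (a := k) (by simpa using hk)
  have h4 : (Finset.card {k | w k = -1} : ℝ) ≠ 0 := by
    rw [Nat.cast_ne_zero]; exact Finset.card_ne_zero_of_mem (a := l) (by simpa using hl)
  simp only [mul_one] at h
  rw [← h]
  simp [meanGap, h3, h4]

theorem sum_gapCoeff_sq (w : κ → ℤ) :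
    ∑ k, gapCoeff w k ^ 2 =
      (Finset.card {k | w k = 1} : ℝ)⁻¹ + (Finset.card {k | w k = -1} : ℝ)⁻¹ := by
  have h : ∀ k, gapCoeff w k ^ 2 =
      (if w k = 1 then ((Finset.card {k | w k = 1} : ℝ))⁻¹ ^ 2 else 0)
        + (if w k = -1 then ((Finset.card {k | w k = -1} : ℝ))⁻¹ ^ 2 else 0) := by
    intro k
    unfold gapCoeff
    by_cases h1 : w k = 1
    · simp [h1]
    · by_cases h2 : w k = -1 <;> simp [h1, h2]
  -- The convention `0⁻¹ = 0` covers empty arrays.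
  have h2 : ∀ c : ℕ, (c : ℝ) * ((c : ℝ)⁻¹) ^ 2 = (c : ℝ)⁻¹ := by
    intro c
    rcases eq_or_ne (c : ℝ) 0 with h | h
    · simp [h]
    · field_simp
  simp only [h, Finset.sum_add_distrib, ← Finset.sum_filter, Finset.sum_const, nsmul_eq_mul, h2]

theorem meanGap_comp_equiv (e : κ ≃ κ') (w : κ' → ℤ) (z : κ' → ℝ) :
    meanGap (fun k => w (e k)) (fun k => z (e k)) = meanGap w z := by
  simp only [meanGap, Finset.sum_filter, Finset.card_filter]
  rw [e.sum_comp fun k => if w k = 1 then z k else 0,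
    e.sum_comp fun k => if w k = -1 then z k else 0,
    e.sum_comp fun k => if w k = 1 then 1 else 0, e.sum_comp fun k => if w k = -1 then 1 else 0]

theorem permutationPValue_comp_equiv [DecidableEq κ] [DecidableEq κ'] (e : κ ≃ κ') (w : κ' → ℤ)
    (z : κ' → ℝ) :
    permutationPValue (fun k => w (e k)) (fun k => z (e k)) = permutationPValue w z := by
  unfold permutationPValue
  rw [Fintype.card_congr e, meanGap_comp_equiv]
  congr 2
  -- Conjugation by `e` matches the permutations of the two index types.
  refine Finset.card_equiv e.permCongr fun σ => ?_
  have := meanGap_comp_equiv e w fun k => z (e.permCongr σ k)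
  simp only [Equiv.permCongr_apply, Equiv.symm_apply_apply] at this
  simp [← this]

end

/-! ### Moments of the permutation distribution -/

section

variable {κ : Type} [Fintype κ] [DecidableEq κ]

/-- The substitution `σ ↦ σ * π` shows that the sum depends only on the orbit of `(k, l)`; as the
symmetric group is 2-transitive, there is one orbit on the diagonal and at most one off it.
Constants for absent orbits are set to 0. -/
theorem exists_sum_perm_mul (z : κ → ℝ) (hz : ∀ k, z k ∈ Set.Icc (0 : ℝ) 1) :
    ∃ c₁ c₂ : ℝ, c₁ ≤ (Fintype.card κ).factorial ∧ 0 ≤ c₂ ∧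
      ∀ k l, ∑ σ : Equiv.Perm κ, z (σ k) * z (σ l) = if k = l then c₁ else c₂ := by
  have key : ∀ π : Equiv.Perm κ, ∀ k l, ∑ σ : Equiv.Perm κ, z (σ (π k)) * z (σ (π l)) =
      ∑ σ : Equiv.Perm κ, z (σ k) * z (σ l) := fun π k l =>
    Equiv.sum_comp (Equiv.mulRight π) fun σ : Equiv.Perm κ => z (σ k) * z (σ l)
  have hnn : ∀ k l, 0 ≤ ∑ σ : Equiv.Perm κ, z (σ k) * z (σ l) := fun k l =>
    Finset.sum_nonneg fun σ _ => mul_nonneg (hz _).1 (hz _).1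
  have hle : ∀ k l, ∑ σ : Equiv.Perm κ, z (σ k) * z (σ l) ≤ (Fintype.card κ).factorial := by
    intro k l
    calc ∑ σ : Equiv.Perm κ, z (σ k) * z (σ l) ≤ ∑ σ : Equiv.Perm κ, 1 :=
          Finset.sum_le_sum fun σ _ => mul_le_one₀ (hz _).2 (hz _).1 (hz _).2
      _ = _ := by simp [Fintype.card_perm]
  have h1 : ∃ c₁ : ℝ, c₁ ≤ (Fintype.card κ).factorial ∧
      ∀ k, ∑ σ : Equiv.Perm κ, z (σ k) * z (σ k) = c₁ := by
    rcases isEmpty_or_nonempty κ with h | ⟨⟨k₀⟩⟩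
    · exact ⟨0, by positivity, fun k => h.elim k⟩
    · refine ⟨_, hle k₀ k₀, fun k => ?_⟩
      simpa using key (Equiv.swap k₀ k) k₀ k₀
  have h2 : ∃ c₂ : ℝ, 0 ≤ c₂ ∧
      ∀ k l, k ≠ l → ∑ σ : Equiv.Perm κ, z (σ k) * z (σ l) = c₂ := by
    by_cases h : ∃ k₀ l₀ : κ, k₀ ≠ l₀
    · obtain ⟨k₀, l₀, h0⟩ := h
      refine ⟨_, hnn k₀ l₀, fun k l hkl => ?_⟩
      have h2t : MulAction.IsMultiplyPretransitive (Equiv.Perm κ) κ 2 :=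
        Equiv.Perm.isMultiplyPretransitive κ 2
      obtain ⟨π, hπ1, hπ2⟩ := MulAction.is_two_pretransitive_iff.1 h2t h0 hkl
      rw [← key π k₀ l₀]
      rw [← hπ1, ← hπ2]
      rfl
    · push Not at h
      exact ⟨0, le_rfl, fun k l hkl => absurd (h k l) hkl⟩
  obtain ⟨c₁, hc1, h1⟩ := h1
  obtain ⟨c₂, hc2, h2⟩ := h2
  refine ⟨c₁, c₂, hc1, hc2, fun k l => ?_⟩
  split_ifs with h
  · rw [h, h1]
  · exact h2 k l h

/-- The second moment of a linear contrast under a uniformly random permutation. -/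
theorem sum_perm_meanGap_sq_le (w : κ → ℤ) (h1 : ∃ k, w k = 1) (h2 : ∃ k, w k = -1) (z : κ → ℝ)
    (hz : ∀ k, z k ∈ Set.Icc (0 : ℝ) 1) :
    ∑ σ : Equiv.Perm κ, meanGap w (fun k => z (σ k)) ^ 2 ≤
      (Fintype.card κ).factorial *
        ((Finset.card {k | w k = 1} : ℝ)⁻¹ + (Finset.card {k | w k = -1} : ℝ)⁻¹) := by
  obtain ⟨c₁, c₂, hc1, hc2, hM⟩ := exists_sum_perm_mul z hz
  have h0 := sum_gapCoeff w h1 h2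
  have hsq := sum_gapCoeff_sq w
  set a := gapCoeff w
  calc ∑ σ : Equiv.Perm κ, meanGap w (fun k => z (σ k)) ^ 2
      = ∑ σ : Equiv.Perm κ, ∑ k, ∑ l, a k * a l * (z (σ k) * z (σ l)) := by
        refine Finset.sum_congr rfl fun σ _ => ?_
        rw [meanGap_eq_sum, sq, Finset.sum_mul_sum]
        refine Finset.sum_congr rfl fun k _ => Finset.sum_congr rfl fun l _ => ?_
        ring
    _ = ∑ k, ∑ l, a k * a l * ∑ σ : Equiv.Perm κ, z (σ k) * z (σ l) := by
        rw [Finset.sum_comm]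
        refine Finset.sum_congr rfl fun k _ => ?_
        rw [Finset.sum_comm]
        simp only [Finset.mul_sum]
    _ = ∑ k, ∑ l, (a k * a l * c₂ + if k = l then a k * a l * (c₁ - c₂) else 0) := by
        refine Finset.sum_congr rfl fun k _ => Finset.sum_congr rfl fun l _ => ?_
        rw [hM]
        split_ifs <;> ring
    _ = (∑ k, a k) * (∑ k, a k) * c₂ + (∑ k, a k ^ 2) * (c₁ - c₂) := by
        simp only [Finset.sum_add_distrib, Finset.sum_ite_eq, Finset.mem_univ, if_true,
          Finset.sum_mul, Finset.mul_sum, sq]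
        rw [Finset.sum_comm]
    _ ≤ _ := by
        -- The `c₂` term vanishes because the coefficients sum to zero, and `c₁ - c₂` is at most the
        -- factorial.
        rw [h0, hsq]
        have : (0 : ℝ) ≤ (Finset.card {k | w k = 1} : ℝ)⁻¹ + (Finset.card {k | w k = -1} : ℝ)⁻¹ := by
          positivity
        nlinarith

/-- Chebyshev's inequality for the contrast under a uniformly random permutation. -/
theorem permutationPValue_le (w : κ → ℤ) (h1 : ∃ k, w k = 1) (h2 : ∃ k, w k = -1) (z : κ → ℝ)
    (hz : ∀ k, z k ∈ Set.Icc (0 : ℝ) 1) {t : ℝ} (ht : 0 < t) (hgap : t ≤ |meanGap w z|) :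
    permutationPValue w z ≤
      ((Finset.card {k | w k = 1} : ℝ)⁻¹ + (Finset.card {k | w k = -1} : ℝ)⁻¹) / t ^ 2 := by
  rw [permutationPValue, div_le_div_iff₀ (by positivity) (by positivity), mul_comm _ (Nat.cast _)]
  refine le_trans ?_ (sum_perm_meanGap_sq_le w h1 h2 z hz)
  rw [← nsmul_eq_mul, ← Finset.sum_const]
  refine (Finset.sum_le_sum fun σ hσ => ?_).trans
    (Finset.sum_le_sum_of_subset_of_nonneg (Finset.subset_univ _) fun σ _ _ => sq_nonneg _)
  rw [← sq_abs (meanGap _ _)]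
  exact pow_le_pow_left₀ ht.le (hgap.trans (Finset.mem_filter.1 hσ).2) 2

end

/-! ### Validity of randomization tests -/

/-- Among the elements of rank at most `c`, counted from the top, take one with the smallest `T`:
all the others are counted in its rank. -/
theorem card_small_rank_le {G : Type} [Fintype G] (T : G → ℝ) {c : ℝ} (hc : 0 ≤ c) :
    (Finset.card {σ | (Finset.card {ρ | T σ ≤ T ρ} : ℝ) ≤ c} : ℝ) ≤ c := by
  classical
  rcases Finset.eq_empty_or_nonempty ({σ | (Finset.card {ρ | T σ ≤ T ρ} : ℝ) ≤ c} : Finset G)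
    with h | h
  · simpa [h] using hc
  · obtain ⟨σ, hσ, hmin⟩ := Finset.exists_min_image _ T h
    refine le_trans (Nat.cast_le.2 (Finset.card_le_card fun ρ hρ => ?_)) (Finset.mem_filter.1 hσ).2
    simpa using hmin ρ hρ

/-- A test that compares a statistic with its values on the orbit under a group that leaves the
law invariant has the level prescribed. -/
theorem sum_randomization_test_le {G Ω : Type} [Group G] [Fintype G] [Fintype Ω]
    (act : G → Ω → Ω) (act_one : ∀ y, act 1 y = y)
    (act_act : ∀ σ τ y, act σ (act τ y) = act (τ * σ) y) (g : Ω → ℝ≥0∞)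
    (hg : ∀ σ y, g (act σ y) = g y) (T : Ω → ℝ) {α : ℝ} (hα : 0 ≤ α) :
    (∑ y with (Finset.card {σ | T y ≤ T (act σ y)} : ℝ) ≤ α * Fintype.card G, g y) ≤
      ENNReal.ofReal α * ∑ y, g y := by
  classical
  let rej : Ω → Prop := fun y => (Finset.card {σ | T y ≤ T (act σ y)} : ℝ) ≤ α * Fintype.card G
  -- Each `act σ` is a bijection preserving `g`, so the rejection mass may be averaged over the
  -- group. It then suffices to count, for fixed `y`, the `σ` for which `act σ y` is rejected.
  have hbij : ∀ σ : G, ∑ y, (if rej (act σ y) then g y else 0) = ∑ y, if rej y then g y else 0 := by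
    intro σ
    let e : Ω ≃ Ω := ⟨act σ, act σ⁻¹, fun y => by rw [act_act, mul_inv_cancel, act_one],
      fun y => by rw [act_act, inv_mul_cancel, act_one]⟩
    rw [← e.sum_comp fun y => if rej y then g y else 0]
    refine Finset.sum_congr rfl fun y _ => ?_
    change _ = if rej (act σ y) then g (act σ y) else 0
    rw [hg]
  have hcard : ∀ y, ((Finset.card {σ | rej (act σ y)} : ℕ) : ℝ≥0∞) ≤
      ENNReal.ofReal α * Fintype.card G := by
    intro y
    have h := card_small_rank_le (fun σ => T (act σ y)) (c := α * Fintype.card G) (by positivity)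
    have h2 : (Finset.univ.filter fun σ => rej (act σ y)) = Finset.univ.filter fun σ =>
        (Finset.card {ρ | T (act σ y) ≤ T (act ρ y)} : ℝ) ≤ α * Fintype.card G := by
      refine Finset.filter_congr fun σ _ => ?_
      -- Starting the orbit at `act σ y` instead of `y` only translates the group, so the rejected
      -- `σ` are those of small rank.
      have : Finset.card {ρ | T (act σ y) ≤ T (act ρ (act σ y))} =
          Finset.card {ρ | T (act σ y) ≤ T (act ρ y)} := by
        refine Finset.card_equiv (Equiv.mulLeft σ) fun ρ => ?_
        simp [act_act]
      simp only [rej, this]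
    rw [h2, ← ENNReal.ofReal_natCast, ← ENNReal.ofReal_natCast, ← ENNReal.ofReal_mul hα]
    exact ENNReal.ofReal_le_ofReal h
  have hG : (Fintype.card G : ℝ≥0∞) ≠ 0 := by simp
  refine (ENNReal.mul_le_mul_iff_right hG (by simp)).1 ?_
  calc (Fintype.card G : ℝ≥0∞) * ∑ y with rej y, g y
      = ∑ σ : G, ∑ y, (if rej (act σ y) then g y else 0) := by
        simp [hbij, Finset.sum_filter]
    _ = ∑ y, (Finset.card {σ | rej (act σ y)} : ℕ) * g y := by
        rw [Finset.sum_comm]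
        refine Finset.sum_congr rfl fun y _ => ?_
        rw [← Finset.sum_filter, Finset.sum_const, nsmul_eq_mul]
    _ ≤ ∑ y, ENNReal.ofReal α * Fintype.card G * g y :=
        Finset.sum_le_sum fun y _ => mul_le_mul_left (hcard y) _
    _ = _ := by rw [← Finset.mul_sum]; ring

/-! ### Pairs of independent decisions -/

theorem pmf_bool_false (u : PMF Bool) : u false = 1 - u true := by
  have h := u.tsum_coe
  rw [tsum_bool] at h
  exact ENNReal.eq_sub_of_add_eq (u.apply_ne_top _) h

theorem pmf_bool_toReal {u : PMF Bool} {s : ℝ} (hs : s ∈ Set.Icc (0 : ℝ) 1)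
    (hu : u true = ENNReal.ofReal s) : (u true).toReal = s ∧ (u false).toReal = 1 - s := by
  rw [pmf_bool_false, hu, ENNReal.toReal_sub_of_le (by simpa using hs.2) (by simp)]
  simp [ENNReal.toReal_ofReal hs.1]

theorem sum_pairLaw_mul {u v : PMF Bool} {s p : ℝ} (hs : s ∈ Set.Icc (0 : ℝ) 1)
    (hp : p ∈ Set.Icc (0 : ℝ) 1) (hu : u true = ENNReal.ofReal s) (hv : v true = ENNReal.ofReal p)
    (z : Bool × Bool → ℝ) :
    ∑ a, (pairLaw u v a).toReal * z a =
      s * p * z (true, true) + s * (1 - p) * z (true, false) + (1 - s) * p * z (false, true)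
        + (1 - s) * (1 - p) * z (false, false) := by
  obtain ⟨h1, h2⟩ := pmf_bool_toReal hs hu
  obtain ⟨h3, h4⟩ := pmf_bool_toReal hp hv
  rw [Fintype.sum_prod_type]
  simp only [Fintype.sum_bool, pairLaw_apply, ENNReal.toReal_mul, h1, h2, h3, h4]
  ring

theorem ofReal_one_sub_le {γ : Type} (p : PMF γ) (S : Set γ) {ε : ℝ} (hε : 0 ≤ ε)
    (h : p.toOuterMeasure Sᶜ ≤ ENNReal.ofReal ε) :
    ENNReal.ofReal (1 - ε) ≤ p.toOuterMeasure S := by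
  have h1 : p.toOuterMeasure Set.univ = 1 :=
    (p.toOuterMeasure_apply_eq_one_iff _).2 (Set.subset_univ _)
  have h2 : p.toOuterMeasure Set.univ ≤ p.toOuterMeasure S + p.toOuterMeasure Sᶜ := by
    rw [← Set.union_compl_self S]
    exact MeasureTheory.measure_union_le _ _
  rw [h1] at h2
  rw [ENNReal.ofReal_sub _ hε, ENNReal.ofReal_one]
  exact tsub_le_iff_right.2 (h2.trans (by gcongr))

theorem exp_neg_le_of_neg_log_le {ε x : ℝ} (hε : 0 < ε) (h : -Real.log ε ≤ x) :
    Real.exp (-x) ≤ ε :=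
  (Real.le_log_iff_exp_le hε).1 (by linarith)

section

variable {κ : Type} [Fintype κ] {w : κ → ℤ} {u v : κ → PMF Bool} {s p : κ → ℝ}

theorem card_pos_of_exists {i : ℤ} (h : ∃ k, w k = i) : (0 : ℝ) < Finset.card {k | w k = i} := by
  obtain ⟨k, hk⟩ := h
  exact_mod_cast Finset.card_pos.2 ⟨k, by simpa using hk⟩

/-! ### The Counting test -/

/-- The difference of the decisions of a pair. -/
def decisionDiff (a : Bool × Bool) : ℝ := (a.1.toNat : ℝ) - (a.2.toNat : ℝ)

theorem abs_decisionDiff_le (a : Bool × Bool) : |decisionDiff a| ≤ 1 := by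
  rcases a with ⟨_ | _, _ | _⟩ <;> simp [decisionDiff]

theorem counting_error_le [DecidableEq κ] {α : ℝ} (hα : α ∈ Set.Ioo (0 : ℝ) 1)
    (hs : ∀ k, s k ∈ Set.Icc (0 : ℝ) 1) (hp : ∀ k, p k ∈ Set.Icc (0 : ℝ) 1)
    (hu : ∀ k, u k true = ENNReal.ofReal (s k)) (hv : ∀ k, v k true = ENNReal.ofReal (p k))
    {ν : ℝ} (hsp : ∀ k, s k = p k + ν) :
    (independent fun k => pairLaw (u k) (v k)).toOuterMeasure
      {x | (∃ k, w k = 1) ∧ (∃ k, w k = -1) ∧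
        Real.sqrt (2 * ((Finset.card {k | w k = 1} : ℝ)⁻¹ + (Finset.card {k | w k = -1} : ℝ)⁻¹)
          * Real.log (2 / α)) < |meanGap w fun k => decisionDiff (x k)|} ≤ ENNReal.ofReal α := by
  by_cases hne : (∃ k, w k = 1) ∧ (∃ k, w k = -1)
  swap
  · have : ∀ q : Prop, ((∃ k, w k = 1) ∧ (∃ k, w k = -1) ∧ q) ↔ False := by tauto
    simp [this]
  obtain ⟨h1, h2⟩ := hne
  have hV : 0 < (Finset.card {k | w k = 1} : ℝ)⁻¹ + (Finset.card {k | w k = -1} : ℝ)⁻¹ :=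
    add_pos (inv_pos.2 (card_pos_of_exists h1)) (inv_pos.2 (card_pos_of_exists h2))
  have hsq := sum_gapCoeff_sq w
  have hL : 0 ≤ Real.log (2 / α) :=
    Real.log_nonneg (by rw [le_div_iff₀ hα.1]; linarith [hα.2])
  set V := (Finset.card {k | w k = 1} : ℝ)⁻¹ + (Finset.card {k | w k = -1} : ℝ)⁻¹ with hVdef
  set t := Real.sqrt (2 * V * Real.log (2 / α)) with ht
  have ht0 : 0 ≤ t := Real.sqrt_nonneg _
  have ht2 : t ^ 2 = 2 * V * Real.log (2 / α) := Real.sq_sqrt (by positivity)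
  have hE : ∀ k, ∑ a, (pairLaw (u k) (v k) a).toReal * decisionDiff a = ν := by
    intro k
    rw [sum_pairLaw_mul (hs k) (hp k) (hu k) (hv k), hsp]
    simp [decisionDiff]
    ring
  -- The threshold of the test is the deviation at which the one-sided Hoeffding bound equals `α /
  -- 2`; `e = 1` and `e = -1` below are the two tails.
  have hexp : Real.exp (-t ^ 2 / (2 * V)) = α / 2 := by
    have : -t ^ 2 / (2 * V) = -Real.log (2 / α) := by rw [ht2]; field_simp
    rw [this, ← Real.log_inv, Real.exp_log (by have := hα.1; positivity), inv_div]
  have hb : ∀ e : ℝ, e ^ 2 = 1 → (independent fun k => pairLaw (u k) (v k)).toOuterMeasure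
      {x | t ≤ e * meanGap w fun k => decisionDiff (x k)} ≤ ENNReal.ofReal (α / 2) := by
    intro e he
    have h := independent_hoeffding (fun k => pairLaw (u k) (v k)) (fun _ => decisionDiff)
      (fun _ => abs_decisionDiff_le) (fun k => e * gapCoeff w k) ht0
    simp only [hE, mul_pow, he, one_mul, hsq, hexp] at h
    refine le_trans (le_of_eq ?_) h
    congr 1
    ext x
    have h3 : ∑ k, e * gapCoeff w k * (decisionDiff (x k) - ν) =
        e * meanGap w fun k => decisionDiff (x k) := by
      simp only [mul_sub, Finset.sum_sub_distrib, ← Finset.sum_mul, ← Finset.mul_sum, mul_assoc,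
        sum_gapCoeff w h1 h2, meanGap_eq_sum]
      ring
    simp only [Set.mem_ofPred_eq, h3]
  refine le_trans (MeasureTheory.OuterMeasure.mono _ (s₂ := _ ∪ _) ?_)
    ((MeasureTheory.measure_union_le _ _).trans
    ((add_le_add (hb 1 (by norm_num)) (hb (-1) (by norm_num))).trans (le_of_eq ?_)))
  · rintro x ⟨-, -, hx⟩
    rcases lt_abs.1 hx with hx | hx
    · left; simpa using hx.le
    · right; simpa using hx.le
  · rw [← ENNReal.ofReal_add (by linarith [hα.1]) (by linarith [hα.1]), add_halves]

/-- Each coefficient has the sign of `w k`, so `d` may be compared termwise with `δ * w`; the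
contrast of `w` itself is `1 - (-1) = 2`. -/
theorem le_sum_gapCoeff_mul (hw : ∀ k, w k = 1 ∨ w k = -1) (h1 : ∃ k, w k = 1)
    (h2 : ∃ k, w k = -1) {d : κ → ℝ} {δ : ℝ} (hd : ∀ k, δ ≤ w k * d k) :
    2 * δ ≤ ∑ k, gapCoeff w k * d k := by
  have hc1 := card_pos_of_exists h1
  have hc2 := card_pos_of_exists h2
  have h : meanGap w (fun k => (w k : ℝ)) = 2 := by
    have e1 : ∑ k with w k = 1, (w k : ℝ) = Finset.card {k | w k = 1} := by
      rw [Finset.sum_congr rfl (g := fun _ => (1 : ℝ)) (by simp +contextual)]; simp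
    have e2 : ∑ k with w k = -1, (w k : ℝ) = -Finset.card {k | w k = -1} := by
      rw [Finset.sum_congr rfl (g := fun _ => (-1 : ℝ)) (by simp +contextual)]; simp
    rw [meanGap, e1, e2, neg_div, div_self hc1.ne', div_self hc2.ne']
    norm_num
  rw [← h, meanGap_eq_sum, Finset.sum_mul]
  refine Finset.sum_le_sum fun k _ => ?_
  have hk := hd k
  rcases hw k with hk1 | hk1
  · have : 0 ≤ gapCoeff w k := by simp [gapCoeff, hk1]
    simp only [hk1, Int.cast_one, one_mul, mul_one] at hk ⊢
    exact mul_le_mul_of_nonneg_left hk this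
  · have : gapCoeff w k ≤ 0 := by simp [gapCoeff, hk1]
    simp only [hk1, Int.cast_neg, Int.cast_one, neg_mul, one_mul, mul_neg, mul_one] at hk ⊢
    nlinarith

theorem counting_power (α : ℝ) {ε δ : ℝ} (hε : 0 < ε) (hδ : 0 < δ) :
    ∃ N : ℕ, ∀ (κ : Type) [Fintype κ] [DecidableEq κ] (w : κ → ℤ) (u v : κ → PMF Bool)
      (s p : κ → ℝ) (ν sgn : ℝ), (∀ k, w k = 1 ∨ w k = -1) →
      N ≤ Finset.card {k | w k = 1} → N ≤ Finset.card {k | w k = -1} →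
      (∀ k, s k ∈ Set.Icc (0 : ℝ) 1) → (∀ k, p k ∈ Set.Icc (0 : ℝ) 1) →
      (∀ k, u k true = ENNReal.ofReal (s k)) → (∀ k, v k true = ENNReal.ofReal (p k)) →
      (sgn = 1 ∨ sgn = -1) → (∀ k, δ ≤ sgn * (w k * (s k - (p k + ν)))) →
      ENNReal.ofReal (1 - ε) ≤ (independent fun k => pairLaw (u k) (v k)).toOuterMeasure
        {x | (∃ k, w k = 1) ∧ (∃ k, w k = -1) ∧
          Real.sqrt (2 * ((Finset.card {k | w k = 1} : ℝ)⁻¹ + (Finset.card {k | w k = -1} : ℝ)⁻¹)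
            * Real.log (2 / α)) < |meanGap w fun k => decisionDiff (x k)|} := by
  -- With `V ≤ 2 / N`, the second bound makes the threshold at most `δ`, and the third makes the
  -- Hoeffding bound `exp (-δ ^ 2 / (2 * V))` at most `ε`.
  obtain ⟨N, hN⟩ := exists_nat_ge
    (max 1 (max (4 * |Real.log (2 / α)| / δ ^ 2) (4 * -Real.log ε / δ ^ 2)))
  simp only [max_le_iff, div_le_iff₀ (pow_pos hδ 2)] at hN
  obtain ⟨hN1, hN2, hN3⟩ := hN
  refine ⟨N, ?_⟩
  intro κ _ _ w u v s p ν sgn hw hc1 hc2 hs hp hu hv hsgn hd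
  have hNpos : (0 : ℝ) < N := by linarith
  have hne : ∀ i, N ≤ Finset.card {k | w k = i} → ∃ k, w k = i := by
    intro i hi
    have : 0 < Finset.card {k | w k = i} := lt_of_lt_of_le (by exact_mod_cast hNpos) hi
    obtain ⟨k, hk⟩ := Finset.card_pos.1 this
    exact ⟨k, by simpa using hk⟩
  have h1 := hne 1 hc1
  have h2 := hne (-1) hc2
  have hV : 0 < (Finset.card {k | w k = 1} : ℝ)⁻¹ + (Finset.card {k | w k = -1} : ℝ)⁻¹ :=
    add_pos (inv_pos.2 (card_pos_of_exists h1)) (inv_pos.2 (card_pos_of_exists h2))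
  have hVN : (Finset.card {k | w k = 1} : ℝ)⁻¹ + (Finset.card {k | w k = -1} : ℝ)⁻¹ ≤ 2 / N := by
    have e1 : (Finset.card {k | w k = 1} : ℝ)⁻¹ ≤ (N : ℝ)⁻¹ :=
      inv_anti₀ hNpos (by exact_mod_cast hc1)
    have e2 : (Finset.card {k | w k = -1} : ℝ)⁻¹ ≤ (N : ℝ)⁻¹ :=
      inv_anti₀ hNpos (by exact_mod_cast hc2)
    rw [div_eq_mul_inv]; linarith
  have hsq := sum_gapCoeff_sq w
  set V := (Finset.card {k | w k = 1} : ℝ)⁻¹ + (Finset.card {k | w k = -1} : ℝ)⁻¹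
  have hVN' : V * N ≤ 2 := (le_div_iff₀ hNpos).1 hVN
  have ht : Real.sqrt (2 * V * Real.log (2 / α)) ≤ δ := by
    rw [Real.sqrt_le_left hδ.le]
    have e1 : 2 * V * Real.log (2 / α) ≤ 2 * V * |Real.log (2 / α)| :=
      mul_le_mul_of_nonneg_left (le_abs_self _) (by positivity)
    have e2 : V * (4 * |Real.log (2 / α)|) ≤ V * (N * δ ^ 2) :=
      mul_le_mul_of_nonneg_left hN2 hV.le
    have e3 : V * N * δ ^ 2 ≤ 2 * δ ^ 2 := mul_le_mul_of_nonneg_right hVN' (by positivity)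
    linarith
  have hsgn2 : sgn ^ 2 = 1 := by rcases hsgn with rfl | rfl <;> norm_num
  have hE : ∀ k, ∑ a, (pairLaw (u k) (v k) a).toReal * decisionDiff a = s k - p k := by
    intro k
    rw [sum_pairLaw_mul (hs k) (hp k) (hu k) (hv k)]
    simp [decisionDiff]
    ring
  have h := independent_hoeffding (fun k => pairLaw (u k) (v k)) (fun _ => decisionDiff)
    (fun _ => abs_decisionDiff_le) (fun k => -sgn * gapCoeff w k) hδ.le
  simp only [hE, mul_pow, neg_sq, hsgn2, one_mul, hsq] at h
  refine ofReal_one_sub_le _ _ hε.le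
    (le_trans (MeasureTheory.OuterMeasure.mono _ ?_) (h.trans (ENNReal.ofReal_le_ofReal ?_)))
  · intro x hx
    have hx' : |meanGap w fun k => decisionDiff (x k)| ≤ δ := by
      by_contra! hlt
      exact hx ⟨h1, h2, ht.trans_lt hlt⟩
    have hmean : 2 * δ ≤ ∑ k, gapCoeff w k * (sgn * (s k - (p k + ν))) :=
      le_sum_gapCoeff_mul hw h1 h2 fun k => (hd k).trans (le_of_eq (by ring))
    -- The unknown shift `ν` enters with the sum of the coefficients, which is zero. A non-rejected
    -- outcome thus lies at least `2δ - δ` below the mean in direction `sgn`.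
    have hsplit : ∑ k, -sgn * gapCoeff w k * (decisionDiff (x k) - (s k - p k)) =
        -(sgn * meanGap w fun k => decisionDiff (x k)) +
          ∑ k, gapCoeff w k * (sgn * (s k - (p k + ν))) + (∑ k, gapCoeff w k) * (sgn * ν) := by
      rw [meanGap_eq_sum, Finset.mul_sum, ← Finset.sum_neg_distrib, Finset.sum_mul,
        ← Finset.sum_add_distrib, ← Finset.sum_add_distrib]
      exact Finset.sum_congr rfl fun k _ => by ring
    rw [Set.mem_ofPred_eq, hsplit, sum_gapCoeff w h1 h2]
    have : sgn * meanGap w (fun k => decisionDiff (x k)) ≤ δ := by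
      rcases hsgn with rfl | rfl
      · linarith [(abs_le.1 hx').2]
      · linarith [(abs_le.1 hx').1]
    linarith
  · rw [neg_div]
    refine exp_neg_le_of_neg_log_le hε ?_
    rw [le_div_iff₀ (by positivity)]
    have e1 : V * (4 * -Real.log ε) ≤ V * (N * δ ^ 2) := mul_le_mul_of_nonneg_left hN3 hV.le
    have e2 : V * N * δ ^ 2 ≤ 2 * δ ^ 2 := mul_le_mul_of_nonneg_right hVN' (by positivity)
    linarith

end

/-! ### The Disagreement test -/

section

variable {κ : Type}

/-- The Disagreement test on a family of pairs of decisions with labels `w`. -/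
def disagreementRejectsPairs [Fintype κ] [DecidableEq κ] (α : ℝ) (w : κ → ℤ)
    (x : κ → Bool × Bool) : Prop :=
  (∃ k : {k // (x k).1 ≠ (x k).2}, w k = 1) ∧ (∃ k : {k // (x k).1 ≠ (x k).2}, w k = -1) ∧
    permutationPValue (fun k : {k // (x k).1 ≠ (x k).2} => w k)
      (fun k => ((x k).1.toNat : ℝ)) ≤ α

/-- Pairs of decisions, described by the disagreements and the first decisions. -/
def disagreementEquiv (κ : Type) : (κ → Bool) × (κ → Bool) ≃ (κ → Bool × Bool) where
  toFun a k := (a.2 k, xor (a.2 k) (a.1 k))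
  invFun x := (fun k => xor (x k).1 (x k).2, fun k => (x k).1)
  left_inv a := by ext k <;> simp
  right_inv x := by ext k <;> simp

theorem disagreementEquiv_ne (d y : κ → Bool) (k : κ) :
    (disagreementEquiv κ (d, y) k).1 ≠ (disagreementEquiv κ (d, y) k).2 ↔ d k = true := by
  cases h1 : d k <;> cases h2 : y k <;> simp [disagreementEquiv, h1, h2]

/-- Replaces an index type depending on the outcome by one depending only on the pattern `d`, so
that a single group acts once `d` is fixed. -/
theorem card_le_of_disagreementRejectsPairs [Fintype κ] [DecidableEq κ] {α : ℝ}
    {w : κ → ℤ} {d y : κ → Bool}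
    (h : disagreementRejectsPairs α w (disagreementEquiv κ (d, y))) :
    (Finset.card {σ : Equiv.Perm {k // d k = true} |
        |meanGap (fun k : {k // d k = true} => w k) (fun k => ((y k).toNat : ℝ))| ≤
          |meanGap (fun k : {k // d k = true} => w k) (fun k => ((y (σ k)).toNat : ℝ))|} : ℝ) ≤
      α * Fintype.card (Equiv.Perm {k // d k = true}) := by
  obtain ⟨-, -, h⟩ := h
  let e := Equiv.subtypeEquivRight (disagreementEquiv_ne d y)
  have h2 := permutationPValue_comp_equiv e (fun k => w k) fun k => ((y k).toNat : ℝ)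
  have h3 : permutationPValue (fun k : {k // d k = true} => w k)
      (fun k => ((y k).toNat : ℝ)) ≤ α := h2.symm.le.trans h
  rw [permutationPValue, div_le_iff₀ (by positivity)] at h3
  rwa [Fintype.card_perm]

/-- If the odds ratio of the two decisions is the same for all pairs, then the law of the first
decisions given the disagreements is invariant under permutations of the disagreements. -/
theorem prod_pair_comp_ofSubtype [Fintype κ] {u v : κ → PMF Bool} {E : ℝ≥0∞}
    (hE : ∀ k, u k true * v k false = E * (u k false * v k true)) (d y : κ → Bool)
    (σ : Equiv.Perm {k // d k = true}) :
    ∏ k, u k (y (Equiv.Perm.ofSubtype σ k)) *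
        v k (xor (y (Equiv.Perm.ofSubtype σ k)) (d k)) =
      ∏ k, u k (y k) * v k (xor (y k) (d k)) := by
  rw [← Fintype.prod_subtype_mul_prod_subtype (fun k => d k = true),
    ← Fintype.prod_subtype_mul_prod_subtype (fun k => d k = true)
      (fun k => u k (y k) * v k (xor (y k) (d k)))]
  congr 1
  -- On a disagreement the weight is a factor free of the decision times `E` if the first decision
  -- is "accept". The product over disagreements depends on `y` only through the number of such
  -- acceptances.
  · have h : ∀ b k, d k = true → u k b * v k (xor b (d k)) =
        (u k false * v k true) * if b = true then E else 1 := by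
      intro b k hk
      cases b
      · simp [hk]
      · simp [hk, hE, mul_comm]
    have h1 : ∀ y' : κ → Bool, ∏ k : {k // d k = true}, u k (y' k) * v k (xor (y' k) (d k)) =
        (∏ k : {k // d k = true}, u k false * v k true) *
          ∏ k : {k // d k = true}, if y' k = true then E else 1 := by
      intro y'
      rw [← Finset.prod_mul_distrib]
      exact Finset.prod_congr rfl fun k _ => h _ _ k.2
    rw [h1 (fun k => y (Equiv.Perm.ofSubtype σ k)), h1 y]
    congr 1
    simp only [Equiv.Perm.ofSubtype_apply_coe]
    exact Equiv.prod_comp σ fun k => if y k = true then E else 1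
  · refine Finset.prod_congr rfl fun k _ => ?_
    rw [Equiv.Perm.ofSubtype_apply_of_not_mem σ k.2]

/-- The outcomes are split by disagreement pattern `d`. For each `d` the weights are invariant under
permuting the disagreements, so rejection takes at most a fraction `α` of the mass of that pattern.
-/
theorem disagreement_error_le [Fintype κ] [DecidableEq κ] {α : ℝ} (hα : 0 ≤ α) (w : κ → ℤ)
    {u v : κ → PMF Bool} {E : ℝ≥0∞}
    (hE : ∀ k, u k true * v k false = E * (u k false * v k true)) :
    (independent fun k => pairLaw (u k) (v k)).toOuterMeasure
      {x | disagreementRejectsPairs α w x} ≤ ENNReal.ofReal α := by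
  classical
  have happ : ∀ d y, independent (fun k => pairLaw (u k) (v k)) (disagreementEquiv κ (d, y)) =
      ∏ k, u k (y k) * v k (xor (y k) (d k)) := fun d y =>
    Finset.prod_congr rfl fun k _ => pairLaw_apply _ _ _ _
  have htotal : ∑ d : κ → Bool, ∑ y : κ → Bool, ∏ k, u k (y k) * v k (xor (y k) (d k)) = 1 := by
    have h := (independent fun k => pairLaw (u k) (v k)).tsum_coe
    rw [tsum_fintype, ← (disagreementEquiv κ).sum_comp, Fintype.sum_prod_type] at h
    simpa only [happ] using h
  rw [PMF.toOuterMeasure_apply, tsum_fintype, ← (disagreementEquiv κ).sum_comp,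
    Fintype.sum_prod_type]
  calc _ ≤ ∑ d : κ → Bool,
        ENNReal.ofReal α * ∑ y : κ → Bool, ∏ k, u k (y k) * v k (xor (y k) (d k)) := by
        refine Finset.sum_le_sum fun d _ => ?_
        refine le_trans ?_ (sum_randomization_test_le (G := Equiv.Perm {k // d k = true})
          (fun σ y k => y (Equiv.Perm.ofSubtype σ k)) (by simp) (by simp) _
          (fun σ y => prod_pair_comp_ofSubtype hE d y σ)
          (fun y => |meanGap (fun k : {k // d k = true} => w k)
            (fun k => ((y k).toNat : ℝ))|) hα)
        rw [Finset.sum_filter]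
        refine Finset.sum_le_sum fun y _ => ?_
        rw [Set.indicator_apply, happ]
        split_ifs with h1 h2
        · exact le_rfl
        · refine absurd (card_le_of_disagreementRejectsPairs h1) ?_
          simpa only [Equiv.Perm.ofSubtype_apply_coe] using h2
        · exact zero_le
        · exact le_rfl
    _ = ENNReal.ofReal α := by rw [← Finset.mul_sum, htotal, mul_one]

/-! ### Power of the Disagreement test -/

/-- The deterministic core of the power proof. Since `|y k - θ| ≤ 1`, large total deviations force
large arrays; since `M₁` and `M₂` bound the array sizes, they also put the two means at least `r`
away from `θ` on opposite sides. -/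
theorem permutation_test_rejects [Fintype κ] [DecidableEq κ] {w : κ → ℤ} {y : κ → ℝ}
    (hy : ∀ k, y k ∈ Set.Icc (0 : ℝ) 1)
    {θ : ℝ} (hθ : θ ∈ Set.Icc (0 : ℝ) 1) {sgn : ℝ} (hsgn : sgn = 1 ∨ sgn = -1) {M₁ M₂ r α : ℝ}
    (hr : 0 < r) (hM1 : 0 < M₁) (hM2 : 0 < M₂) (hc1 : (Finset.card {k | w k = 1} : ℝ) ≤ M₁)
    (hc2 : (Finset.card {k | w k = -1} : ℝ) ≤ M₂)
    (h1 : r * M₁ ≤ sgn * ∑ k with w k = 1, (y k - θ))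
    (h2 : r * M₂ ≤ -sgn * ∑ k with w k = -1, (y k - θ))
    (hα : ((r * M₁)⁻¹ + (r * M₂)⁻¹) / (2 * r) ^ 2 ≤ α) :
    (∃ k, w k = 1) ∧ (∃ k, w k = -1) ∧ permutationPValue w y ≤ α := by
  have habs : |sgn| = 1 := by rcases hsgn with rfl | rfl <;> simp
  have hcard : ∀ i : ℤ, |∑ k with w k = i, (y k - θ)| ≤ Finset.card {k | w k = i} := by
    intro i
    refine (Finset.abs_sum_le_sum_abs _ _).trans ((Finset.sum_le_sum (g := fun _ => (1 : ℝ))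
      fun k _ => ?_).trans (by simp))
    rw [abs_le]
    constructor <;> linarith [(hy k).1, (hy k).2, hθ.1, hθ.2]
  have hn1 : r * M₁ ≤ Finset.card {k | w k = 1} :=
    (h1.trans (le_abs_self _)).trans (by rw [abs_mul, habs, one_mul]; exact hcard 1)
  have hn2 : r * M₂ ≤ Finset.card {k | w k = -1} :=
    (h2.trans (le_abs_self _)).trans (by rw [abs_mul, abs_neg, habs, one_mul]; exact hcard (-1))
  have hp1 : (0 : ℝ) < Finset.card {k | w k = 1} := lt_of_lt_of_le (by positivity) hn1
  have hp2 : (0 : ℝ) < Finset.card {k | w k = -1} := lt_of_lt_of_le (by positivity) hn2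
  have hne : ∀ i : ℤ, (0 : ℝ) < Finset.card {k | w k = i} → ∃ k, w k = i := by
    intro i hi
    obtain ⟨k, hk⟩ := Finset.card_pos.1 (by exact_mod_cast hi)
    exact ⟨k, by simpa using hk⟩
  refine ⟨hne _ hp1, hne _ hp2, ?_⟩
  have hmean : ∀ i : ℤ, (0 : ℝ) < Finset.card {k | w k = i} →
      (∑ k with w k = i, y k) / Finset.card {k | w k = i} =
        θ + (∑ k with w k = i, (y k - θ)) / Finset.card {k | w k = i} := by
    intro i hi
    rw [Finset.sum_sub_distrib, Finset.sum_const, nsmul_eq_mul]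
    field_simp
    ring
  have hgap : 2 * r ≤ sgn * meanGap w y := by
    have e1 : r ≤ sgn * ((∑ k with w k = 1, (y k - θ)) / Finset.card {k | w k = 1}) := by
      rw [← mul_div_assoc, le_div_iff₀ hp1]
      exact (mul_le_mul_of_nonneg_left hc1 hr.le).trans h1
    have e2 : r ≤ -sgn * ((∑ k with w k = -1, (y k - θ)) / Finset.card {k | w k = -1}) := by
      rw [← mul_div_assoc, le_div_iff₀ hp2]
      exact (mul_le_mul_of_nonneg_left hc2 hr.le).trans h2
    rw [meanGap, hmean 1 hp1, hmean (-1) hp2]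
    linarith
  have hgap' : 2 * r ≤ |meanGap w y| :=
    (hgap.trans (le_abs_self _)).trans (by rw [abs_mul, habs, one_mul])
  refine (permutationPValue_le w (hne _ hp1) (hne _ hp2) y hy (by positivity) hgap').trans
    (le_trans ?_ hα)
  gcongr

/-- The contribution of a pair to the comparison of the first decisions of the disagreeing pairs
with `θ`. -/
def disagreementScore (θ : ℝ) (a : Bool × Bool) : ℝ :=
  if a.1 ≠ a.2 then (a.1.toNat : ℝ) - θ else 0

theorem abs_disagreementScore_le {θ : ℝ} (hθ : θ ∈ Set.Icc (0 : ℝ) 1) (a : Bool × Bool) :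
    |disagreementScore θ a| ≤ 1 := by
  have h1 := hθ.1
  have h2 := hθ.2
  rcases a with ⟨_ | _, _ | _⟩ <;> simp [disagreementScore, abs_le] <;> constructor <;> linarith

/-- Turns a sum over an array of random size into a sum over a fixed index set, to which Hoeffding's
inequality applies. -/
theorem sum_disagreementScore [Fintype κ] [DecidableEq κ] (w : κ → ℤ) (i : ℤ) (θ : ℝ)
    (x : κ → Bool × Bool) :
    ∑ k ∈ Finset.univ.filter (fun k : {k // (x k).1 ≠ (x k).2} => w k = i),
        (((x k).1.toNat : ℝ) - θ) =
      ∑ k with w k = i, disagreementScore θ (x k) := by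
  rw [Finset.sum_filter, Finset.sum_filter,
    ← Finset.sum_subtype (Finset.univ.filter fun k => (x k).1 ≠ (x k).2) (by simp)
      (fun k => if w k = i then ((x k).1.toNat : ℝ) - θ else 0), Finset.sum_filter]
  refine Finset.sum_congr rfl fun k _ => ?_
  unfold disagreementScore
  split_ifs <;> rfl

theorem card_filter_subtype_le [Fintype κ] (q : κ → Prop) [DecidablePred q] (w : κ → ℤ) (i : ℤ) :
    Finset.card {k : {k // q k} | w k = i} ≤ Finset.card {k | w k = i} := by
  refine Finset.card_le_card_of_injOn (fun k => (k : κ)) (fun k hk => ?_)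
    Subtype.val_injective.injOn
  simpa using hk

/-- With `θ = e / (1 + e)` the expected score is affine in `s` and vanishes at the null value of
`s`; the factor on the right is its slope. -/
theorem expectation_disagreementScore {s p e : ℝ} (he : 0 < e) (hp : p ∈ Set.Icc (0 : ℝ) 1) :
    s * (1 - p) * (1 - e / (1 + e)) - (1 - s) * p * (e / (1 + e)) =
      (1 - p + p * e) / (1 + e) * (s - p * e / (1 - p + p * e)) := by
  have h : 0 < 1 - p + p * e := by
    rcases hp.1.eq_or_lt with h | h
    · rw [← h]; norm_num
    · have := mul_pos h he
      linarith [hp.2]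
  field_simp
  ring

end

/-- The expected score of a pair deviates from zero at least by this factor times the deviation
of the acceptance probability. -/
theorem le_score_factor {Δ ν p : ℝ} (hν : ν ∈ Set.Ioo (-Δ) Δ) (hp : p ∈ Set.Icc (0 : ℝ) 1) :
    Real.exp (-Δ) / (1 + Real.exp Δ) ≤ (1 - p + p * Real.exp ν) / (1 + Real.exp ν) := by
  have h1 : Real.exp (-Δ) ≤ Real.exp ν := Real.exp_le_exp.2 hν.1.le
  have h2 : Real.exp ν ≤ Real.exp Δ := Real.exp_le_exp.2 hν.2.le
  have h3 : Real.exp (-Δ) ≤ 1 := Real.exp_le_one_iff.2 (by linarith [hν.1, hν.2])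
  -- A convex combination of `1` and `exp ν`, both at least `exp (-Δ)`.
  have h4 : Real.exp (-Δ) ≤ 1 - p + p * Real.exp ν := by
    nlinarith [mul_le_mul_of_nonneg_left h1 hp.1,
      mul_le_mul_of_nonneg_left h3 (sub_nonneg.2 hp.2)]
  have := Real.exp_pos ν
  have := Real.exp_pos (-Δ)
  gcongr
  linarith

theorem disagreement_power {α ε δ Δ : ℝ} (hα : 0 < α) (hε : 0 < ε) (hδ : 0 < δ) :
    ∃ N : ℕ, ∀ (κ : Type) [Fintype κ] [DecidableEq κ] (w : κ → ℤ) (u v : κ → PMF Bool)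
      (s p : κ → ℝ) (ν sgn : ℝ), (∀ k, w k = 1 ∨ w k = -1) →
      N ≤ Finset.card {k | w k = 1} → N ≤ Finset.card {k | w k = -1} →
      (∀ k, s k ∈ Set.Icc (0 : ℝ) 1) → (∀ k, p k ∈ Set.Icc (0 : ℝ) 1) →
      (∀ k, u k true = ENNReal.ofReal (s k)) → (∀ k, v k true = ENNReal.ofReal (p k)) →
      ν ∈ Set.Ioo (-Δ) Δ → (sgn = 1 ∨ sgn = -1) →
      (∀ k, δ ≤ sgn * (w k * (s k - p k * Real.exp ν / (1 - p k + p k * Real.exp ν)))) →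
      ENNReal.ofReal (1 - ε) ≤ (independent fun k => pairLaw (u k) (v k)).toOuterMeasure
        {x | disagreementRejectsPairs α w x} := by
  obtain ⟨c, hc⟩ : ∃ c, c = Real.exp (-Δ) / (1 + Real.exp Δ) := ⟨_, rfl⟩
  have hc0 : 0 < c := by rw [hc]; positivity
  obtain ⟨r, hr⟩ : ∃ r, r = c * δ / 2 := ⟨_, rfl⟩
  have hr0 : 0 < r := by rw [hr]; positivity
  -- Each pair has expected signed score at least `c * δ = 2 * r`, and half of it is given up to
  -- fluctuations. The second bound makes the p-value bound `1 / (2 * r ^ 3 * N)` at most `α`; the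
  -- third makes the Hoeffding bound `exp (-r ^ 2 * N / 2)` at most `ε / 2` for each label.
  obtain ⟨N, hN⟩ := exists_nat_ge
    (max 1 (max (1 / (2 * r ^ 3 * α)) (2 * -Real.log (ε / 2) / r ^ 2)))
  simp only [max_le_iff, div_le_iff₀ (pow_pos hr0 2)] at hN
  obtain ⟨hN1, hN2, hN3⟩ := hN
  rw [div_le_iff₀ (by positivity)] at hN2
  refine ⟨N, ?_⟩
  intro κ _ _ w u v s p ν sgn hw hc1 hc2 hs hp hu hv hν hsgn hd
  have hNpos : (0 : ℝ) < N := by linarith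
  have he := Real.exp_pos ν
  obtain ⟨θ, hθdef⟩ : ∃ θ, θ = Real.exp ν / (1 + Real.exp ν) := ⟨_, rfl⟩
  have hθ : θ ∈ Set.Icc (0 : ℝ) 1 := by
    rw [hθdef]
    exact ⟨by positivity, (div_le_one (by positivity)).2 (by linarith)⟩
  have hE : ∀ k, 2 * r ≤ sgn * (w k *
      ∑ a, (pairLaw (u k) (v k) a).toReal * disagreementScore θ a) := by
    intro k
    have hsum : ∑ a, (pairLaw (u k) (v k) a).toReal * disagreementScore θ a =
        (1 - p k + p k * Real.exp ν) / (1 + Real.exp ν) *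
          (s k - p k * Real.exp ν / (1 - p k + p k * Real.exp ν)) := by
      rw [sum_pairLaw_mul (hs k) (hp k) (hu k) (hv k), ← expectation_disagreementScore he (hp k),
        ← hθdef]
      simp [disagreementScore]
      ring
    rw [hsum]
    have h1 := le_score_factor hν (hp k)
    rw [← hc] at h1
    have h2 := mul_le_mul h1 (hd k) hδ.le (hc0.le.trans h1)
    linarith
  have hb : ∀ i : ℤ, (i = 1 ∨ i = -1) → N ≤ Finset.card {k | w k = i} →
      (independent fun k => pairLaw (u k) (v k)).toOuterMeasure
        {x | sgn * i * ∑ k with w k = i, disagreementScore θ (x k) <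
          r * Finset.card {k | w k = i}} ≤ ENNReal.ofReal (ε / 2) := by
    intro i hi hci
    have hi2 : (i : ℝ) ^ 2 = 1 := by rcases hi with rfl | rfl <;> norm_num
    have hsgn2 : sgn ^ 2 = 1 := by rcases hsgn with rfl | rfl <;> norm_num
    have hM : (N : ℝ) ≤ Finset.card {k | w k = i} := by exact_mod_cast hci
    have hsq : ∑ k, (if w k = i then -sgn * (i : ℝ) else 0) ^ 2 = Finset.card {k | w k = i} := by
      simp only [ite_pow, mul_pow, neg_sq, hi2, hsgn2, mul_one, ne_eq, OfNat.ofNat_ne_zero,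
        not_false_eq_true, zero_pow, Finset.sum_boole]
    have h := independent_hoeffding (fun k => pairLaw (u k) (v k)) (fun _ => disagreementScore θ)
      (fun _ => abs_disagreementScore_le hθ) (fun k => if w k = i then -sgn * (i : ℝ) else 0)
      (t := r * Finset.card {k | w k = i}) (by positivity)
    rw [hsq] at h
    refine le_trans (MeasureTheory.OuterMeasure.mono _ ?_) (h.trans (ENNReal.ofReal_le_ofReal ?_))
    · intro x hx
      rw [Set.mem_ofPred_eq] at hx ⊢
      simp only [ite_mul, zero_mul, ← Finset.sum_filter]
      simp only [mul_sub, Finset.sum_sub_distrib, ← Finset.mul_sum]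
      have hmean : 2 * r * Finset.card {k | w k = i} ≤ ∑ k with w k = i, sgn * i *
          ∑ a, (pairLaw (u k) (v k) a).toReal * disagreementScore θ a := by
        rw [mul_comm, ← nsmul_eq_mul, ← Finset.sum_const]
        refine Finset.sum_le_sum fun k hk => (hE k).trans (le_of_eq ?_)
        rw [(Finset.mem_filter.1 hk).2]
        ring
      rw [← Finset.mul_sum] at hmean
      linarith
    · rw [neg_div]
      refine exp_neg_le_of_neg_log_le (by positivity) ?_
      have hM0 := hNpos.trans_le hM
      have : (r * (Finset.card {k | w k = i} : ℝ)) ^ 2 / (2 * Finset.card {k | w k = i}) =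
          r ^ 2 * Finset.card {k | w k = i} / 2 := by
        field_simp
      rw [this]
      have := mul_le_mul_of_nonneg_left hM (sq_nonneg r)
      linarith
  refine ofReal_one_sub_le _ _ hε.le
    (le_trans (MeasureTheory.OuterMeasure.mono _ (s₂ := _ ∪ _) ?_)
      ((MeasureTheory.measure_union_le _ _).trans
        ((add_le_add (hb 1 (Or.inl rfl) hc1) (hb (-1) (Or.inr rfl) hc2)).trans (le_of_eq ?_))))
  · intro x hx
    by_contra hnot
    rw [Set.mem_union, not_or] at hnot
    obtain ⟨hx1, hx2⟩ := hnot
    rw [Set.mem_ofPred_eq, not_lt] at hx1 hx2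
    have hM1 : (N : ℝ) ≤ Finset.card {k | w k = 1} := by exact_mod_cast hc1
    have hM2 : (N : ℝ) ≤ Finset.card {k | w k = -1} := by exact_mod_cast hc2
    refine hx (permutation_test_rejects (θ := θ) (sgn := sgn) (r := r)
      (M₁ := Finset.card {k | w k = 1}) (M₂ := Finset.card {k | w k = -1})
      (fun k => ?_) hθ hsgn hr0 (by linarith) (by linarith)
      (Nat.cast_le.2 (card_filter_subtype_le _ _ _)) (Nat.cast_le.2 (card_filter_subtype_le _ _ _))
      ?_ ?_ ?_)
    · cases (x k).1 <;> simp
    · rw [sum_disagreementScore w 1 θ x]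
      simpa using hx1
    · rw [sum_disagreementScore w (-1) θ x]
      simpa using hx2
    · calc ((r * (Finset.card {k | w k = 1} : ℝ))⁻¹ + (r * (Finset.card {k | w k = -1} : ℝ))⁻¹) /
            (2 * r) ^ 2 ≤ ((r * N)⁻¹ + (r * N)⁻¹) / (2 * r) ^ 2 := by gcongr
        _ = 1 / (2 * r ^ 3) / N := by field_simp; ring
        _ ≤ α := by
          rw [div_le_iff₀ hNpos, div_le_iff₀ (by positivity)]
          linarith
  · rw [← ENNReal.ofReal_add (by positivity) (by positivity), add_halves]

/-! ### The two models -/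

/-- The label of a paper. -/
def paperSign {n : ℕ} (J : Finset (Fin n)) (j : Fin n) : ℤ := if j ∈ J then 1 else -1

theorem paperSign_eq {n : ℕ} (J : Finset (Fin n)) (j : Fin n) :
    paperSign J j = 1 ∨ paperSign J j = -1 := by
  unfold paperSign
  split_ifs <;> simp

theorem card_inter_le_card_paperSign {n : ℕ} (J P : Finset (Fin n)) :
    (P ∩ J).card ≤ Finset.card {j : P | paperSign J j = 1} := by
  refine (Finset.card_le_card (t := Finset.image (fun j : P => (j : Fin n))
    {j : P | paperSign J j = 1}) fun j hj => ?_).trans Finset.card_image_le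
  obtain ⟨h1, h2⟩ := Finset.mem_inter.1 hj
  exact Finset.mem_image.2 ⟨⟨j, h1⟩, by simp [paperSign, h2], rfl⟩

theorem card_sdiff_le_card_paperSign {n : ℕ} (J P : Finset (Fin n)) :
    (P \ J).card ≤ Finset.card {j : P | paperSign J j = -1} := by
  refine (Finset.card_le_card (t := Finset.image (fun j : P => (j : Fin n))
    {j : P | paperSign J j = -1}) fun j hj => ?_).trans Finset.card_image_le
  obtain ⟨h1, h2⟩ := Finset.mem_sdiff.1 hj
  exact Finset.mem_image.2 ⟨⟨j, h1⟩, by simp [paperSign, h2], rfl⟩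

theorem countingRejects_pairTuples (α : ℝ) {n : ℕ} (J P : Finset (Fin n)) :
    pairTuples J P ⁻¹' {T | countingRejects α n T} =
      {x | (∃ k : P, paperSign J k = 1) ∧ (∃ k : P, paperSign J k = -1) ∧
        Real.sqrt (2 * ((Finset.card {k : P | paperSign J k = 1} : ℝ)⁻¹
          + (Finset.card {k : P | paperSign J k = -1} : ℝ)⁻¹) * Real.log (2 / α)) <
          |meanGap (fun k : P => paperSign J k) fun k => decisionDiff (x k)|} :=
  rfl

theorem disagreementRejects_pairTuples (α : ℝ) {n : ℕ} (J P : Finset (Fin n)) :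
    pairTuples J P ⁻¹' {T | disagreementRejects α n T} =
      {x | disagreementRejectsPairs α (fun k : P => paperSign J k) x} :=
  rfl

/-- The sign encodes the direction of the bias, so that both alternatives are treated at once. -/
theorem exists_sign_of_alternative {m n : ℕ} {J : Finset (Fin n)} {f : ℝ → ℝ} {δ : ℝ}
    {Psb Pdb : Matrix (Fin m) (Fin n) unitInterval}
    (h : AlternativeWithMargin J f δ Psb Pdb ∨ AlternativeWithMargin Jᶜ f δ Psb Pdb) :
    ∃ sgn : ℝ, (sgn = 1 ∨ sgn = -1) ∧
      ∀ i j, δ ≤ sgn * (paperSign J j * ((Psb i j : ℝ) - f (Pdb i j))) := by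
  rcases h with ⟨h1, h2⟩ | ⟨h1, h2⟩
  · refine ⟨1, Or.inl rfl, fun i j => ?_⟩
    have h := h2 i j
    by_cases hj : j ∈ J
    · rw [abs_of_nonneg (sub_nonneg.2 ((h1 i j).1 hj))] at h
      simpa [paperSign, hj] using h.le
    · rw [abs_of_nonpos (sub_nonpos.2 ((h1 i j).2 hj))] at h
      simpa [paperSign, hj] using h.le
  · refine ⟨-1, Or.inr rfl, fun i j => ?_⟩
    have h := h2 i j
    by_cases hj : j ∈ J
    · rw [abs_of_nonpos (sub_nonpos.2 ((h1 i j).2 (by simpa using hj)))] at h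
      simpa [paperSign, hj] using h.le
    · rw [abs_of_nonneg (sub_nonneg.2 ((h1 i j).1 (by simpa using hj)))] at h
      simpa [paperSign, hj] using h.le

/-- Log-odds determine the probability, and here they depend on the paper only. This is needed
because the hypotheses compare `Psb` and `Pdb` for one reviewer, while a tuple involves two. -/
theorem logisticDBModel_eq {Δ : ℝ} {m n : ℕ} {Pdb : Matrix (Fin m) (Fin n) unitInterval}
    (h : logisticDBModel Δ m n Pdb) (i i' : Fin m) (j : Fin n) :
    (Pdb i j : ℝ) = Pdb i' j := by
  obtain ⟨b0, b1, q, -, -, -, -, h⟩ := h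
  obtain ⟨h1, h2⟩ := h i j
  obtain ⟨h3, h4⟩ := h i' j
  have h5 := sub_pos.2 h1.2
  have h6 := sub_pos.2 h3.2
  have := Real.log_injOn_pos (div_pos h1.1 h5) (div_pos h3.1 h6) (h2.trans h4.symm)
  rw [div_eq_div_iff h5.ne' h6.ne'] at this
  linarith

/-- Shifting the log-odds by `ν` multiplies the odds by `e = exp ν` whatever `p` is: the constant
odds ratio behind exchangeability. -/
theorem logistic_odds_ratio {p e : ℝ} (hp : p ∈ Set.Ioo (0 : ℝ) 1) (he : 0 < e) :
    p * e / (1 - p + p * e) * (1 - p) = e * ((1 - p * e / (1 - p + p * e)) * p) := by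
  have := mul_pos hp.1 he
  have : 1 - p + p * e ≠ 0 := by linarith [hp.2]
  field_simp
  ring

/-! ### Type-I error and power of the two tests under their models. -/

theorem counting_controlsTypeIError {α : ℝ} (hα : α ∈ Set.Ioo (0 : ℝ) 1) (lam mu : ℕ) (Δ : ℝ) :
    ControlsTypeIError lam mu (linearDBModel Δ) (linearClass Δ) (countingRejects α) α := by
  rintro m n hm J β bidLaw alg sel Psb Pdb beh ⟨q, -, hq⟩ f ⟨ν, -, rfl⟩ hnull
  refine procedure_toOuterMeasure_le hm bidLaw alg sel beh _ _ fun P rs rd u v hu hv => ?_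
  rw [countingRejects_pairTuples]
  refine counting_error_le hα (fun k => (Psb (rs k) k).2) (fun k => (Pdb (rd k) k).2) hu hv
    (ν := ν) fun k => ?_
  rw [hnull, hq, hq]

theorem counting_hasNontrivialPower (α : ℝ) {lam : ℕ} (hlam : 1 ≤ lam) (mu : ℕ) (Δ : ℝ) :
    HasNontrivialPower lam mu (linearDBModel Δ) (linearClass Δ) (countingRejects α) := by
  intro ε hε δ hδ
  obtain ⟨N, hN⟩ := counting_power α hε hδ
  obtain ⟨n₀, hn₀⟩ := exists_le_card_of_isSelection (mu := mu) hlam N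
  refine ⟨n₀, ?_⟩
  rintro m n hm hmn J hJ β bidLaw alg sel Psb Pdb beh ⟨q, -, hq⟩ f ⟨ν, -, rfl⟩ halt
  obtain ⟨sgn, hsgn, hd⟩ := exists_sign_of_alternative halt
  refine le_procedure_toOuterMeasure hm bidLaw alg sel beh _ _ fun P rs rd u v hP hu hv => ?_
  obtain ⟨hc1, hc2⟩ := hn₀ m n hmn hm J P hJ hP
  rw [countingRejects_pairTuples]
  refine hN P _ u v _ _ ν sgn (fun k => paperSign_eq J k)
    (hc1.trans (card_inter_le_card_paperSign J P)) (hc2.trans (card_sdiff_le_card_paperSign J P))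
    (fun k => (Psb (rs k) k).2) (fun k => (Pdb (rd k) k).2) hu hv hsgn fun k => ?_
  have h := hd (rs k) k
  -- The DB probability depends on the paper only, so that of the SB reviewer may be exchanged for
  -- that of the DB reviewer.
  rwa [hq (rs k), ← hq (rd k)] at h

theorem disagreement_controlsTypeIError {α : ℝ} (hα : 0 ≤ α) (lam mu : ℕ) (Δ : ℝ) :
    ControlsTypeIError lam mu (logisticDBModel Δ) (logisticClass Δ) (disagreementRejects α) α := by
  rintro m n hm J β bidLaw alg sel Psb Pdb beh hmodel f ⟨ν, -, rfl⟩ hnull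
  refine procedure_toOuterMeasure_le hm bidLaw alg sel beh _ _ fun P rs rd u v hu hv => ?_
  rw [disagreementRejects_pairTuples]
  refine disagreement_error_le hα _ (E := ENNReal.ofReal (Real.exp ν)) fun k => ?_
  obtain ⟨h1, h2⟩ := pmf_bool_toReal (Psb (rs k) k).2 (hu k)
  obtain ⟨h3, h4⟩ := pmf_bool_toReal (Pdb (rd k) k).2 (hv k)
  have h5 := hnull (rs k) k
  rw [logisticDBModel_eq hmodel (rs k) (rd k) k] at h5
  obtain ⟨b0, b1, q, -, -, -, -, h⟩ := hmodel
  have h6 := logistic_odds_ratio (h (rd k) k).1 (Real.exp_pos ν)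
  refine (ENNReal.toReal_eq_toReal_iff' (ENNReal.mul_ne_top ((u k).apply_ne_top _)
    ((v k).apply_ne_top _)) (ENNReal.mul_ne_top ENNReal.ofReal_ne_top (ENNReal.mul_ne_top
      ((u k).apply_ne_top _) ((v k).apply_ne_top _)))).1 ?_
  simp only [ENNReal.toReal_mul, h1, h2, h3, h4, ENNReal.toReal_ofReal (Real.exp_pos ν).le, h5]
  exact h6

theorem disagreement_hasNontrivialPower {α : ℝ} (hα : 0 < α) {lam : ℕ} (hlam : 1 ≤ lam) (mu : ℕ)
    (Δ : ℝ) :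
    HasNontrivialPower lam mu (logisticDBModel Δ) (logisticClass Δ) (disagreementRejects α) := by
  intro ε hε δ hδ
  obtain ⟨N, hN⟩ := disagreement_power (Δ := Δ) hα hε hδ
  obtain ⟨n₀, hn₀⟩ := exists_le_card_of_isSelection (mu := mu) hlam N
  refine ⟨n₀, ?_⟩
  rintro m n hm hmn J hJ β bidLaw alg sel Psb Pdb beh hmodel f ⟨ν, hν, rfl⟩ halt
  obtain ⟨sgn, hsgn, hd⟩ := exists_sign_of_alternative halt
  refine le_procedure_toOuterMeasure hm bidLaw alg sel beh _ _ fun P rs rd u v hP hu hv => ?_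
  obtain ⟨hc1, hc2⟩ := hn₀ m n hmn hm J P hJ hP
  rw [disagreementRejects_pairTuples]
  refine hN P _ u v _ _ ν sgn (fun k => paperSign_eq J k)
    (hc1.trans (card_inter_le_card_paperSign J P)) (hc2.trans (card_sdiff_le_card_paperSign J P))
    (fun k => (Psb (rs k) k).2) (fun k => (Pdb (rd k) k).2) hu hv hν hsgn fun k => ?_
  have h := hd (rs k) k
  rwa [logisticDBModel_eq hmodel (rs k) (rd k) k] at h

end BiasTest

theorem theorem2 (α : ℝ) (hα : α ∈ Set.Ioo (0 : ℝ) 1) (lam mu : ℕ) (hlam : 1 ≤ lam)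
    (hmu : 1 ≤ mu) :
    (∀ Δ ∈ Set.Ioo (0 : ℝ) (1 / 2),
      BiasTest.ControlsTypeIError lam mu (BiasTest.linearDBModel Δ) (BiasTest.linearClass Δ)
          (BiasTest.countingRejects α) α ∧
        BiasTest.HasNontrivialPower lam mu (BiasTest.linearDBModel Δ) (BiasTest.linearClass Δ)
          (BiasTest.countingRejects α)) ∧
    (∀ Δ : ℝ, 0 < Δ →
      BiasTest.ControlsTypeIError lam mu (BiasTest.logisticDBModel Δ) (BiasTest.logisticClass Δ)
          (BiasTest.disagreementRejects α) α ∧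
        BiasTest.HasNontrivialPower lam mu (BiasTest.logisticDBModel Δ) (BiasTest.logisticClass Δ)
          (BiasTest.disagreementRejects α)) :=
  ⟨fun Δ _ => ⟨BiasTest.counting_controlsTypeIError hα lam mu Δ,
      BiasTest.counting_hasNontrivialPower α hlam mu Δ⟩,
    fun Δ _ => ⟨BiasTest.disagreement_controlsTypeIError hα.1.le lam mu Δ,
      BiasTest.disagreement_hasNontrivialPower hα.1 hlam mu Δ⟩⟩
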